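/- **Setting.** Let $D\subset\mathbb R^d$ be open. Consider the integro-differential operator $$Af(x)=\tfrac12\operatorname{Tr}\big(\mathbf Q(x)\nabla^2 f(x)\big)+b(x)\cdot\nabla f(x)+\int_{\mathbb R^d}\Big(f(x+y)-f(x)-\frac{y\cdot\nabla f(x)}{1+|y|^2}\Big)N(x,dy),$$ where $\mathbf Q=[q_{i,j}]$ and $b$ are bounded and Borel on $\mathbb R^d$, $\mathbf Q(x)$ is non-negative definite, and $N$ is a kernel of Borel measures on $\mathbb R^d\setminus\{0\}$ with $\sup_{x}\int\min\{1,|y|^2\}N(x,dy)<\infty$. Let $(P_x)_{x\in\mathbb R^d}$, with expectations $\mathbb E_x$, be a strong Markovian solution of the martingale problem for $A$. That is, $(P_x)$ is a measurable family of probability measures on the space of càdlàg paths in $\mathbb R^d$, with canonical process $(X_t)_{t\ge0}$ and natural filtration $(\mathcal F_t)$, such that - for every $x$, $P_x[X_0=x]=1$ and for every $f\in C_b^2(\mathbb R^d)$ the process $f(X_t)-f(X_0)-\int_0^tAf(X_r)\,dr$ is an $(\mathcal F_t)$-martingale under $P_x$; - $(X_t)$ is strongly Markovian with respect to $(\mathcal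 F_t)$ and $(P_x)$; - for every Borel probability measure $\mu$ on $\mathbb R^d$, $\int P_x\,\mu(dx)$ solves the same martingale problem with initial distribution $\mu$. Let $\tau_D=\inf\{t>0: X_t\notin D\}$ and assume $P_x[\tau_D<\infty]=1$ for all $x\in D$. Let $c:D\to[0,\infty)$ be bounded and Borel, let $g:D\to(-\infty,0]$ be Borel, and put $$\bar c_D=\sup_D c,\qquad g^-=\max\{-g,0\},\qquad e_c(t)=\exp\Big(-\int_0^tc(X_r)\,dr\Big),\qquad v_{c,D}(x)=\mathbb E_x\,e_c(\tau_D).$$ For $\alpha\ge0$ and Borel $f:D\to[0,\infty)$ let $R^D_\alpha f(x)=\mathbb E_x\int_0^{\tau_D}e^{-\alpha t}f(X_t)\,dt\in[0,\infty]$. The minorization condition $M(\alpha,\psi,\nu)$, for a function $\psi:D\to[0,\infty)$ and a $\sigma$-finite Borel measure $\nu$ on $D$, says that $$R^D_\alpha f(x)\ge\psi(x)\int_Df\,d\nu\qquad\text{for all }x\in D\text{ and all bounded Borel }f:D\to[0,\infty).$$ Let $D_S=D\cup\partial D\cup\bigcup_{x\in D}\big(x+\operatorname{supp}N(x,\cdot)\big)$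 and $\bar u_{D_S}=\sup_{D_S}u$. A weak subsolution of $(-A+c)v=g$ in $D$ is a bounded Borel function $u:\mathbb R^d\to\mathbb R$ such that $$u(x)\le\mathbb E_x\big[e_c(\tau_D\wedge t)\,u(X_{\tau_D\wedge t})\big]+\mathbb E_x\Big[\int_0^{\tau_D\wedge t}e_c(r)g(X_r)\,dr\Big]\qquad\text{for all }x\in D,\ t\ge0.$$ **Theorem.** Assume that $M(\bar c_D,\psi,\nu)$ holds for some $\psi:D\to[0,\infty)$ and some $\sigma$-finite Borel measure $\nu$ on $D$. Then every weak subsolution $u$ of $(-A+c)v=g$ in $D$ with $\bar u_{D_S}\ge0$ satisfies $$\bar u_{D_S}-u(x)\ \ge\ \psi(x)\Big\{\bar u_{D_S}\int_Dc\,v_{c,D}\,d\nu+\int_Dg^-\,d\nu\Big\},\qquad x\in D,$$ where the integrals take values in $[0,\infty]$ and $0\cdot\infty=0$. -/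

import Mathlib

open MeasureTheory ProbabilityTheory Set Filter Topology
open scoped NNReal ENNReal

namespace LevyHopf

/-- The Euclidean space `ℝᵈ`. -/
abbrev Space (d : ℕ) : Type := EuclideanSpace ℝ (Fin d)

/-- Càdlàg functions `ω : [0,∞) → ℝᵈ`: right continuous with left limits in `ℝᵈ`. -/
def Path (d : ℕ) : Type :=
  {ω : ℝ≥0 → Space d //
    ∀ t, ContinuousWithinAt ω (Ici t) t ∧ ∃ l, Tendsto ω (𝓝[<] t) (𝓝 l)}

/-- The canonical process: `ω t` is the position `X_t(ω)`. -/
instance (d : ℕ) : CoeFun (Path d) (fun _ => ℝ≥0 → Space d) := ⟨Subtype.val⟩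

/-- The `σ`-algebra generated by the coordinate maps `X_t`, which is the Borel `σ`-algebra of the
Skorokhod topology. -/
instance (d : ℕ) : MeasurableSpace (Path d) :=
  inferInstanceAs (MeasurableSpace {ω : ℝ≥0 → Space d //
    ∀ t, ContinuousWithinAt ω (Ici t) t ∧ ∃ l, Tendsto ω (𝓝[<] t) (𝓝 l)})

theorem measurable_coord {d : ℕ} (t : ℝ≥0) : Measurable (fun ω : Path d => ω t) :=
  (measurable_pi_apply t).comp measurable_subtype_coe

/-- The natural filtration `ℱ_t = σ(X_s : s ≤ t)` of the canonical process. -/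
noncomputable def canonicalFiltration (d : ℕ) :
    Filtration ℝ≥0 (inferInstance : MeasurableSpace (Path d)) :=
  Filtration.natural (fun (t : ℝ≥0) (ω : Path d) => ω t)
    (fun t => (measurable_coord t).stronglyMeasurable)

/-- The shift `(θ_s ω)(r) = ω (s + r)`. -/
def shift {d : ℕ} (s : ℝ≥0) (ω : Path d) : Path d :=
  ⟨fun r => ω (s + r), by
    intro t
    obtain ⟨hr, l, hl⟩ := ω.2 (s + t)
    refine ⟨?_, l, ?_⟩
    · refine ContinuousWithinAt.comp (t := Ici (s + t)) hr (by fun_prop) ?_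
      intro r hrt
      exact add_le_add_right (mem_Ici.1 hrt) s
    · refine hl.comp (tendsto_nhdsWithin_iff.2 ⟨?_, ?_⟩)
      · exact ((continuous_const.add continuous_id).tendsto t).mono_left nhdsWithin_le_nhds
      · filter_upwards [self_mem_nhdsWithin] with r hrt
        exact add_lt_add_right (mem_Iio.1 hrt) s⟩

/-- Coefficients of an integro-differential operator on `ℝᵈ`: diffusion matrix `q`, drift `b`
and Lévy kernel `N`. -/
structure Coefficients (d : ℕ) where
  q : Space d → Matrix (Fin d) (Fin d) ℝ
  b : Space d → Fin d → ℝ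
  N : Kernel (Space d) (Space d)

namespace Coefficients

variable {d : ℕ}

/-- The assumptions on the coefficients: `q` and `b` are bounded and Borel, `q` is non-negative
definite, `N(x, ·)` is a measure on `ℝᵈ ∖ {0}` (a measure on `ℝᵈ` that does not charge `0`) and
`sup_x ∫ min{1, |y|²} N(x, dy) < ∞`, which makes `N(x, ·)` `σ`-finite. -/
structure Admissible (A : Coefficients d) : Prop where
  measurable_q : ∀ i j, Measurable fun x => A.q x i j
  bounded_q : ∀ i j, ∃ C : ℝ, ∀ x, |A.q x i j| ≤ C
  nonneg_q : ∀ x (ξ : Fin d → ℝ), 0 ≤ ∑ i, ∑ j, A.q x i j * ξ i * ξ j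
  measurable_b : ∀ i, Measurable fun x => A.b x i
  bounded_b : ∀ i, ∃ C : ℝ, ∀ x, |A.b x i| ≤ C
  levy_zero : ∀ x, A.N x {0} = 0
  levy_bound : ⨆ x, ∫⁻ y, ENNReal.ofReal (min 1 (‖y‖ ^ 2)) ∂(A.N x) < ⊤

/-- `A f (x) = ½ Tr (Q(x) ∇²f(x)) + b(x) · ∇f(x)
  + ∫ (f(x+y) - f(x) - y · ∇f(x) / (1 + |y|²)) N(x, dy)`. -/
noncomputable def apply (A : Coefficients d) (f : Space d → ℝ) (x : Space d) : ℝ :=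
  (1 / 2) * ∑ i, ∑ j, A.q x i j *
      iteratedFDeriv ℝ 2 f x ![EuclideanSpace.single i 1, EuclideanSpace.single j 1]
    + ∑ i, A.b x i * fderiv ℝ f x (EuclideanSpace.single i 1)
    + ∫ y, (f (x + y) - f x - fderiv ℝ f x y / (1 + ‖y‖ ^ 2)) ∂(A.N x)

/-- `𝒮(D) = ⋃_{x ∈ D} (x + supp N(x, ·))`, the range of non-locality over `D`. -/
def nonlocalRange (A : Coefficients d) (D : Set (Space d)) : Set (Space d) :=
  ⋃ x ∈ D, (fun y => x + y) '' (A.N x).support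

/-- The extended boundary `∂_S D = ∂D ∪ (𝒮(D) ∖ D)`. -/
def extBoundary (A : Coefficients d) (D : Set (Space d)) : Set (Space d) :=
  frontier D ∪ (A.nonlocalRange D \ D)

/-- `D_S = ∂_S D ∪ D`. -/
def extClosure (A : Coefficients d) (D : Set (Space d)) : Set (Space d) :=
  A.extBoundary D ∪ D

end Coefficients

variable {d : ℕ}

/-- `f ∈ C_b²(ℝᵈ)`: `f` is `C²` and bounded together with its first two derivatives. -/
def IsCb2 (f : Space d → ℝ) : Prop :=
  ContDiff ℝ 2 f ∧ ∃ C : ℝ, ∀ x,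
    |f x| ≤ C ∧ ‖fderiv ℝ f x‖ ≤ C ∧ ‖iteratedFDeriv ℝ 2 f x‖ ≤ C

/-- `Pμ` solves the martingale problem for `A` with initial distribution `μ`. -/
structure SolvesMartingaleProblem (A : Coefficients d) (μ : Measure (Space d))
    (Pμ : Measure (Path d)) : Prop where
  isProbabilityMeasure : IsProbabilityMeasure Pμ
  initial : Pμ.map (fun ω => ω 0) = μ
  martingale : ∀ f : Space d → ℝ, IsCb2 f →
    Martingale (fun (t : ℝ≥0) (ω : Path d) =>
      f (ω t) - f (ω 0) - ∫ r in (0 : ℝ)..t, A.apply f (ω r.toNNReal))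
      (canonicalFiltration d) Pμ

/-- A strong Markovian solution `(P_x)` of the martingale problem for `A`. The measurability of
`x ↦ P_x C` is part of `P` being a kernel. The strong Markov property says that
`P_x(θ_τ⁻¹ C | ℱ_τ) = P_{X_τ}(C)` almost surely on `{τ < ∞}`, for all stopping times `τ` of the
natural filtration; it is written out over the sets `B ∈ ℱ_τ`. -/
structure IsStrongMarkovSolution (A : Coefficients d) (P : Kernel (Space d) (Path d)) :
    Prop where
  solves : ∀ x, SolvesMartingaleProblem A (Measure.dirac x) (P x)
  strongMarkov : ∀ (x : Space d) (τ : Path d → WithTop ℝ≥0)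
    (hτ : IsStoppingTime (canonicalFiltration d) τ) (B C : Set (Path d)),
    MeasurableSet[hτ.measurableSpace] B → MeasurableSet C →
      P x (B ∩ {ω | τ ω ≠ ⊤ ∧ shift ((τ ω).untopD 0) ω ∈ C}) =
        ∫⁻ ω in B ∩ {ω | τ ω ≠ ⊤}, P (ω ((τ ω).untopD 0)) C ∂(P x)
  mixture : ∀ μ : Measure (Space d), IsProbabilityMeasure μ →
    SolvesMartingaleProblem A μ (μ.bind P)

/-- The exit time `τ_D = inf {t > 0 : X_t ∉ D}`, with values in `[0, ∞]`. -/
noncomputable def exitTime (D : Set (Space d)) (ω : Path d) : ℝ≥0∞ :=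
  sInf {T : ℝ≥0∞ | ∃ t : ℝ≥0, 0 < t ∧ ω t ∉ D ∧ T = t}

/-- `τ_D ∧ t`. -/
noncomputable def exitTimeMin (D : Set (Space d)) (t : ℝ≥0) (ω : Path d) : ℝ≥0 :=
  (min (exitTime D ω) t).toNNReal

/-- `e_c(t) = exp (-∫₀ᵗ c(X_r) dr)`. It is used for `t ≤ τ_D` only, so that only the values of
`c` on `D` matter. -/
noncomputable def discount (c : Space d → ℝ) (t : ℝ≥0) (ω : Path d) : ℝ :=
  Real.exp (-∫ r in (0 : ℝ)..t, c (ω r.toNNReal))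

open Classical in
/-- The gauge function `v_{c,D}(x) = 𝔼_x e_c(τ_D)` for `c ≥ 0`; if `τ_D = ∞` then
`e_c(∞) = lim_{t → ∞} e_c(t) = inf_t e_c(t)`. -/
noncomputable def gauge (P : Kernel (Space d) (Path d)) (D : Set (Space d))
    (c : Space d → ℝ) (x : Space d) : ℝ :=
  ∫ ω, (if exitTime D ω = ⊤ then ⨅ t : ℝ≥0, discount c t ω
    else discount c (exitTime D ω).toNNReal ω) ∂(P x)

/-- The resolvent `R^D_α f(x) = 𝔼_x ∫₀^{τ_D} e^{-α t} f(X_t) dt` of a non-negative function. -/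
noncomputable def resolvent (P : Kernel (Space d) (Path d)) (D : Set (Space d)) (α : ℝ)
    (f : Space d → ℝ≥0∞) (x : Space d) : ℝ≥0∞ :=
  ∫⁻ ω, (∫⁻ t in {t : ℝ | 0 ≤ t ∧ ENNReal.ofReal t < exitTime D ω},
    ENNReal.ofReal (Real.exp (-α * t)) * f (ω t.toNNReal)) ∂(P x)

/-- The minorization condition `M(α, ψ, ν)`: `ν` is a `σ`-finite Borel measure on `D` and
`R^D_α f(x) ≥ ψ(x) ∫_D f dν` for all `x ∈ D` and all bounded non-negative Borel functions `f`.
The measure on `D` is the restriction of `ν` to `D`, a function on `D` is extended to `ℝᵈ`, and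
the values of `ψ` and `f` off `D` play no role. -/
structure Minorization (P : Kernel (Space d) (Path d)) (D : Set (Space d)) (α : ℝ)
    (ψ : Space d → ℝ≥0) (ν : Measure (Space d)) : Prop where
  sigmaFinite : SigmaFinite (ν.restrict D)
  le_resolvent : ∀ f : Space d → ℝ≥0, Measurable f → (∃ C, ∀ x, f x ≤ C) → ∀ x ∈ D,
    (ψ x : ℝ≥0∞) * ∫⁻ y in D, (f y : ℝ≥0∞) ∂ν ≤ resolvent P D α (fun y => (f y : ℝ≥0∞)) x

/-- Weak subsolutions of `(-A + c) v = g` in `D`, where `c ≥ 0` and `g ≤ 0` on `D`: bounded Borel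
functions `u` on `ℝᵈ` with
`u(x) ≤ 𝔼_x[e_c(τ_D ∧ t) u(X_{τ_D ∧ t})] + 𝔼_x ∫₀^{τ_D ∧ t} e_c(r) g(X_r) dr` for `x ∈ D`, `t ≥ 0`.
As `g ≤ 0`, the second expectation always exists in `[-∞, 0]`; it is written as minus the integral
of `-g ≥ 0`. -/
structure IsWeakSubsolution (P : Kernel (Space d) (Path d)) (D : Set (Space d))
    (c g u : Space d → ℝ) : Prop where
  measurable : Measurable u
  bounded : ∃ C : ℝ, ∀ x, |u x| ≤ C
  le_expectation : ∀ x ∈ D, ∀ t : ℝ≥0,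
    (u x : EReal) ≤
      ((∫ ω, discount c (exitTimeMin D t ω) ω * u (ω (exitTimeMin D t ω)) ∂(P x) : ℝ) : EReal)
      - ((∫⁻ ω, (∫⁻ r in Ioo (0 : ℝ) (exitTimeMin D t ω),
          ENNReal.ofReal (discount c r.toNNReal ω * -g (ω r.toNNReal))) ∂(P x) : ℝ≥0∞) : EReal)

end LevyHopf

/-!
Fix `x ∈ D`, write `U` for the supremum of `u` over `D_S` and `C` for the supremum of `c` over `D`.
Let `t ≥ 0`. The process stopped at `τ_D ∧ t` is in `D` or has left it for a point of `D_S`, so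
that `u ≤ U` there almost surely and, as `U ≥ 0`, a weak subsolution satisfies

`U - u(x) ≥ U 𝔼_x (1 - e_c(τ_D ∧ t)) + 𝔼_x ∫₀^{τ_D ∧ t} e_c(r) g⁻(X_r) dr`.

Since `c ≤ C` one has `e_c(r) ≥ e^{-C r}` and `1 - e_c(s) ≥ ∫₀^s e^{-C r} c(X_r) dr`
(`integral_exp_mul_le_one_sub_exp`); letting `t → ∞` gives `U - u(x) ≥ R^D_C (U c + g⁻)(x)`. The
minorization condition, applied to truncations of `U c + g⁻`, bounds the resolvent from below by
`ψ(x) ∫_D (U c + g⁻) dν`, and `c ≥ c v_{c,D}` because the gauge function is at most one.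

The probabilistic content is in the position at time `τ_D ∧ t`, which needs two facts.

* `τ_D` is the hitting time of a closed set and need not be measurable. A solution of the martingale
  problem has no jumps at the limit `σ` of the hitting times `H n` of open neighbourhoods of `Dᶜ`:
  Dynkin's formula gives `𝔼 f (X_{H n}) → 𝔼 f (X_σ)` for bounded `C²` functions `f`, and with
  `f` positive on a part of `D` and zero elsewhere this forces `X_σ ∉ D` on `{σ < t}`. Hence
  `τ_D ∧ t = σ` almost surely, and `σ` is an optional time
  (`SolvesMartingaleProblem.exists_optionalTime_ae_eq_exitTimeMin`).
* For a bounded `C²` function `f ≥ 0` vanishing on `D`, Dynkin's formula reads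
  `𝔼 f (X_σ) = 𝔼 ∫₀^σ ∫ f (X_r + y) N(X_r, dy) dr`. Both sides extend from functions to open sets,
  and by outer regularity `X_σ` avoids every Borel set off `closure D` that `N(y, ·)` does not
  charge from any `y ∈ D` (`SolvesMartingaleProblem.ae_eval_notMem`), in particular the part of
  `{u > U}` off `closure D`.
-/

open MeasureTheory ProbabilityTheory Set Filter Topology
open scoped NNReal ENNReal

namespace LevyHopf

/-! ### The operator on bounded `C²` functions -/

theorem IsCb2.of_hasCompactSupport {d : ℕ} {f : Space d → ℝ} (hf : ContDiff ℝ 2 f)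
    (hs : HasCompactSupport f) : IsCb2 f := by
  obtain ⟨C₀, h₀⟩ := hs.exists_bound_of_continuous hf.continuous
  obtain ⟨C₁, h₁⟩ := (hs.fderiv ℝ).exists_bound_of_continuous
    (hf.continuous_fderiv (by norm_num))
  obtain ⟨C₂, h₂⟩ := (hs.iteratedFDeriv (𝕜 := ℝ) 2).exists_bound_of_continuous
    (hf.continuous_iteratedFDeriv le_rfl)
  refine ⟨hf, max C₀ (max C₁ C₂), fun x => ⟨?_, ?_, ?_⟩⟩
  · exact (h₀ x).trans (le_max_left _ _)
  · exact (h₁ x).trans ((le_max_left _ _).trans (le_max_right _ _))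
  · exact (h₂ x).trans ((le_max_right _ _).trans (le_max_right _ _))

/-- Taylor's formula for small `y` and boundedness for large `y`. -/
theorem IsCb2.exists_levyIntegrand_le {d : ℕ} {f : Space d → ℝ} (hf : IsCb2 f) :
    ∃ K : ℝ, 0 ≤ K ∧ ∀ x y, |f (x + y) - f x - fderiv ℝ f x y / (1 + ‖y‖ ^ 2)|
      ≤ K * min 1 (‖y‖ ^ 2) := by
  obtain ⟨hf, C, hC⟩ := hf
  have hC0 : 0 ≤ C := (abs_nonneg _).trans (hC 0).1
  have hlip : ∀ z x, ‖fderiv ℝ f z - fderiv ℝ f x‖ ≤ C * ‖z - x‖ := by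
    intro z x
    refine Convex.norm_image_sub_le_of_norm_fderiv_le (𝕜 := ℝ) (s := univ) (fun w _ => ?_)
      (fun w _ => ?_) convex_univ (mem_univ _) (mem_univ _)
    · exact ((hf.fderiv_right (m := 1) (by norm_num)).differentiable (by norm_num)) w
    · have h1 := norm_iteratedFDeriv_fderiv (𝕜 := ℝ) (f := f) (n := 1) (x := w)
      have h2 := norm_iteratedFDeriv_fderiv (𝕜 := ℝ) (f := fderiv ℝ f) (n := 0) (x := w)
      rw [norm_iteratedFDeriv_zero] at h2
      exact (h2.trans h1).le.trans (hC w).2.2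
  refine ⟨3 * C, by positivity, fun x y => ?_⟩
  have hd : |fderiv ℝ f x y| ≤ C * ‖y‖ :=
    ((fderiv ℝ f x).le_opNorm y).trans (by gcongr; exact (hC x).2.1)
  have hpos : 0 < 1 + ‖y‖ ^ 2 := by positivity
  rcases le_or_gt ‖y‖ 1 with hy | hy
  · rw [min_eq_right (by nlinarith [norm_nonneg y])]
    have htay : |f (x + y) - f x - fderiv ℝ f x y| ≤ C * ‖y‖ * ‖y‖ := by
      have := (convex_closedBall x ‖y‖).norm_image_sub_le_of_norm_fderiv_le' (𝕜 := ℝ) (f := f)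
        (φ := fderiv ℝ f x) (C := C * ‖y‖) (x := x) (y := x + y)
        (fun w _ => hf.differentiable (by norm_num) w)
        (fun w hw => (hlip w x).trans (by
          gcongr; simpa [dist_eq_norm] using hw))
        (by simp) (by simp)
      simpa using this
    have hdec : f (x + y) - f x - fderiv ℝ f x y / (1 + ‖y‖ ^ 2)
        = (f (x + y) - f x - fderiv ℝ f x y)
          + fderiv ℝ f x y * (‖y‖ ^ 2 / (1 + ‖y‖ ^ 2)) := by
      field_simp; ring
    have hfr : ‖y‖ ^ 2 / (1 + ‖y‖ ^ 2) ≤ ‖y‖ ^ 2 :=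
      div_le_self (by positivity) (by nlinarith [sq_nonneg ‖y‖])
    rw [hdec]
    refine (abs_add_le _ _).trans ?_
    rw [abs_mul, abs_of_nonneg (a := ‖y‖ ^ 2 / (1 + ‖y‖ ^ 2)) (by positivity)]
    have h2 : |fderiv ℝ f x y| * (‖y‖ ^ 2 / (1 + ‖y‖ ^ 2)) ≤ C * ‖y‖ ^ 2 :=
      mul_le_mul (hd.trans (by nlinarith [norm_nonneg y])) hfr (by positivity) hC0
    nlinarith [sq_nonneg ‖y‖]
  · rw [min_eq_left (by nlinarith)]
    have h2 : |fderiv ℝ f x y / (1 + ‖y‖ ^ 2)| ≤ C := by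
      rw [abs_div, abs_of_pos hpos, div_le_iff₀ hpos]
      refine hd.trans ?_
      gcongr
      nlinarith
    have h3 := abs_le.1 (hC (x + y)).1
    have h4 := abs_le.1 (hC x).1
    have h5 := abs_le.1 h2
    rw [abs_le]
    constructor <;> linarith

theorem exists_smooth_bump_support {d : ℕ} {V : Set (Space d)} (hV : IsOpen V)
    (hb : Bornology.IsBounded V) :
    ∃ f : Space d → ℝ, f.support = V ∧ IsCb2 f ∧ ∀ x, 0 ≤ f x ∧ f x ≤ 1 := by
  obtain ⟨f, hs, hf, hr⟩ := hV.exists_contDiff_support_eq (n := 2)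
  refine ⟨f, hs, IsCb2.of_hasCompactSupport hf ?_, fun x => hr (mem_range_self x)⟩
  rw [HasCompactSupport, tsupport, hs]
  exact hb.isCompact_closure

/-- The indicator of a bounded open set is the pointwise limit of bounded `C²` functions. -/
theorem exists_smooth_tendsto_indicator {d : ℕ} {V : Set (Space d)} (hV : IsOpen V)
    (hb : Bornology.IsBounded V) :
    ∃ f : ℕ → Space d → ℝ, (∀ n, IsCb2 (f n)) ∧ (∀ n x, 0 ≤ f n x ∧ f n x ≤ 1) ∧
      (∀ n x, x ∉ V → f n x = 0) ∧ ∀ x ∈ V, Tendsto (fun n => f n x) atTop (𝓝 1) := by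
  obtain ⟨f, hs, ⟨hf, -⟩, hr⟩ := exists_smooth_bump_support hV hb
  have hz : ∀ (n : ℕ) x, x ∉ V → Real.smoothTransition (n * f x) = 0 := by
    intro n x hx
    have : f x = 0 := by
      rw [← hs] at hx
      simpa using hx
    simp [this]
  refine ⟨fun n x => Real.smoothTransition (n * f x), fun n => ?_, fun n x =>
    ⟨Real.smoothTransition.nonneg _, Real.smoothTransition.le_one _⟩, hz, fun x hx => ?_⟩
  · refine IsCb2.of_hasCompactSupport ?_ ?_
    · exact Real.smoothTransition.contDiff.comp (contDiff_const.mul hf)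
    · refine hb.isCompact_closure.of_isClosed_subset (isClosed_tsupport _) ?_
      refine closure_mono fun x hx => ?_
      by_contra h
      exact hx (hz n x h)
  · have hpos : 0 < f x := by
      refine lt_of_le_of_ne (hr x).1 (Ne.symm ?_)
      rwa [← hs] at hx
    refine tendsto_const_nhds.congr' ?_
    filter_upwards [eventually_ge_atTop ⌈(f x)⁻¹⌉₊] with n hn
    refine (Real.smoothTransition.one_of_one_le ?_).symm
    rw [← div_le_iff₀ hpos, one_div]
    exact Nat.ceil_le.1 hn

namespace Coefficients

variable {d : ℕ} {A : Coefficients d}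

theorem Admissible.exists_levy_bound (hA : A.Admissible) :
    ∃ L : ℝ≥0∞, L < ⊤ ∧
      ∀ x, ∫⁻ y, ENNReal.ofReal (min 1 (‖y‖ ^ 2)) ∂(A.N x) ≤ L :=
  ⟨_, hA.levy_bound, fun x => le_iSup (fun x =>
    ∫⁻ y, ENNReal.ofReal (min 1 (‖y‖ ^ 2)) ∂(A.N x)) x⟩

theorem Admissible.exists_tail_bound (hA : A.Admissible) {ε : ℝ} (hε : 0 < ε) :
    ∃ K : ℝ≥0∞, K < ⊤ ∧ ∀ x, A.N x {y | ε ≤ ‖y‖} ≤ K := by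
  obtain ⟨L, hL, h⟩ := hA.exists_levy_bound
  have hm' : ε ≠ 0 := hε.ne'
  refine ⟨L / ENNReal.ofReal (min 1 (ε ^ 2)), ENNReal.div_lt_top hL.ne (by simpa using hm'),
    fun x => ?_⟩
  rw [ENNReal.le_div_iff_mul_le (Or.inl (by simpa using hm')) (Or.inl ENNReal.ofReal_ne_top),
    mul_comm]
  refine le_trans ?_ ((mul_meas_ge_le_lintegral₀ (by fun_prop)
    (ENNReal.ofReal (min 1 (ε ^ 2)))).trans (h x))
  gcongr with y
  intro (hy : ε ≤ ‖y‖)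
  exact ENNReal.ofReal_le_ofReal (by gcongr)

theorem Admissible.isSFiniteKernel (hA : A.Admissible) : IsSFiniteKernel A.N := by
  let φ : Space d → ℕ := fun y => ⌊‖y‖⁻¹⌋₊
  have hφ : Measurable φ := by fun_prop
  have hS : ∀ n, MeasurableSet (φ ⁻¹' {n}) := fun n => hφ (measurableSet_singleton n)
  refine ⟨fun n => A.N.restrict (hS n), fun n => ?_, ?_⟩
  · obtain ⟨K, hK, h⟩ := hA.exists_tail_bound (ε := ((n : ℝ) + 1)⁻¹) (by positivity)
    refine ⟨K, hK, fun x => ?_⟩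
    rw [Kernel.restrict_apply, Measure.restrict_apply_univ]
    refine (measure_mono (t := {0} ∪ {y | ((n : ℝ) + 1)⁻¹ ≤ ‖y‖}) fun y hy => ?_).trans
      ((measure_union_le _ _).trans ?_)
    · rcases eq_or_ne y 0 with rfl | hy0
      · simp
      · right
        have h1 : ⌊‖y‖⁻¹⌋₊ = n := hy
        have h2 := Nat.lt_floor_add_one ‖y‖⁻¹
        rw [h1] at h2
        exact inv_le_of_inv_le₀ (by positivity) h2.le
    · rw [hA.levy_zero, zero_add]
      exact h x
  · ext x s hs
    rw [Kernel.sum_apply' _ _ hs]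
    simp_rw [Kernel.restrict_apply' _ _ _ hs]
    rw [← measure_iUnion]
    · rw [← inter_iUnion, ← preimage_iUnion, iUnion_of_singleton, preimage_univ, inter_univ]
    · intro i j hij
      exact ((disjoint_singleton.2 hij).preimage φ).mono inter_subset_right inter_subset_right
    · exact fun n => hs.inter (hS n)

theorem Admissible.measurable_apply (hA : A.Admissible) {f : Space d → ℝ} (hf : IsCb2 f) :
    Measurable (A.apply f) := by
  have := hA.isSFiniteKernel
  have hq := hA.measurable_q
  have hb := hA.measurable_b
  have h2 : Continuous (iteratedFDeriv ℝ 2 f) := hf.1.continuous_iteratedFDeriv le_rfl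
  have h1 : Continuous (fderiv ℝ f) := hf.1.continuous_fderiv (by norm_num)
  have h0 : Continuous f := hf.1.continuous
  have hF : StronglyMeasurable fun p : Space d × Space d =>
      f (p.1 + p.2) - f p.1 - fderiv ℝ f p.1 p.2 / (1 + ‖p.2‖ ^ 2) := by
    refine Continuous.stronglyMeasurable ?_
    refine ((h0.comp (continuous_fst.add continuous_snd)).sub (h0.comp continuous_fst)).sub ?_
    refine Continuous.div ((h1.comp continuous_fst).clm_apply continuous_snd) (by fun_prop) ?_
    intro p
    positivity
  refine Measurable.add (Measurable.add ?_ ?_) ?_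
  · refine Measurable.const_mul (Finset.measurable_fun_sum _ fun i _ =>
      Finset.measurable_fun_sum _ fun j _ => (hq i j).mul ?_) _
    exact (h2.eval_const _).measurable
  · refine Finset.measurable_fun_sum _ fun i _ => (hb i).mul ?_
    exact (h1.clm_apply continuous_const).measurable
  · exact (hF.integral_kernel_prod_right' (κ := A.N)).measurable

theorem Admissible.bounded_apply (hA : A.Admissible) {f : Space d → ℝ} (hf : IsCb2 f) :
    ∃ C : ℝ, 0 ≤ C ∧ ∀ x, |A.apply f x| ≤ C := by
  obtain ⟨K, hK0, hK⟩ := hf.exists_levyIntegrand_le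
  obtain ⟨L, hL, hN⟩ := hA.exists_levy_bound
  obtain ⟨-, C, hC⟩ := hf
  have hC0 : 0 ≤ C := (abs_nonneg _).trans (hC 0).1
  choose Cq hq using hA.bounded_q
  choose Cb hb using hA.bounded_b
  have hq0 : ∀ i j, 0 ≤ Cq i j := fun i j => (abs_nonneg _).trans (hq i j 0)
  have hb0 : ∀ i, 0 ≤ Cb i := fun i => (abs_nonneg _).trans (hb i 0)
  refine ⟨(1 / 2) * ∑ i, ∑ j, Cq i j * C + ∑ i, Cb i * C
    + (ENNReal.ofReal K * L).toReal, ?_, fun x => ?_⟩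
  · have h1 : 0 ≤ ∑ i, ∑ j, Cq i j * C :=
      Finset.sum_nonneg fun i _ => Finset.sum_nonneg fun j _ => mul_nonneg (hq0 i j) hC0
    have h2 : 0 ≤ ∑ i, Cb i * C := Finset.sum_nonneg fun i _ => mul_nonneg (hb0 i) hC0
    positivity
  refine (abs_add_le _ _).trans (add_le_add ((abs_add_le _ _).trans (add_le_add ?_ ?_)) ?_)
  · rw [abs_mul, abs_of_pos (by norm_num : (0 : ℝ) < 1 / 2)]
    gcongr
    refine (Finset.abs_sum_le_sum_abs _ _).trans (Finset.sum_le_sum fun i _ => ?_)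
    refine (Finset.abs_sum_le_sum_abs _ _).trans (Finset.sum_le_sum fun j _ => ?_)
    rw [abs_mul]
    refine mul_le_mul (hq i j x) ?_ (abs_nonneg _) (hq0 i j)
    refine (ContinuousMultilinearMap.le_opNorm (iteratedFDeriv ℝ 2 f x) _).trans ?_
    simpa [Fin.prod_univ_two] using (hC x).2.2
  · refine (Finset.abs_sum_le_sum_abs _ _).trans (Finset.sum_le_sum fun i _ => ?_)
    rw [abs_mul]
    refine mul_le_mul (hb i x) ?_ (abs_nonneg _) (hb0 i)
    refine (ContinuousLinearMap.le_opNorm (fderiv ℝ f x) _).trans ?_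
    simpa using (hC x).2.1
  · rw [← Real.norm_eq_abs]
    refine (norm_integral_le_lintegral_norm _).trans ?_
    refine ENNReal.toReal_mono (ENNReal.mul_ne_top ENNReal.ofReal_ne_top hL.ne) ?_
    calc ∫⁻ y, ENNReal.ofReal ‖f (x + y) - f x - fderiv ℝ f x y / (1 + ‖y‖ ^ 2)‖ ∂(A.N x)
        ≤ ∫⁻ y, ENNReal.ofReal K * ENNReal.ofReal (min 1 (‖y‖ ^ 2)) ∂(A.N x) := by
          refine lintegral_mono fun y => ?_
          rw [← ENNReal.ofReal_mul hK0]
          exact ENNReal.ofReal_le_ofReal (hK x y)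
      _ = ENNReal.ofReal K * ∫⁻ y, ENNReal.ofReal (min 1 (‖y‖ ^ 2)) ∂(A.N x) :=
          lintegral_const_mul _ (by fun_prop)
      _ ≤ _ := by gcongr; exact hN x

/-- On an open set where `f` vanishes only the non-local part of `A f` remains. -/
theorem apply_eq_of_eqOn_zero {f : Space d → ℝ} {D : Set (Space d)} (hD : IsOpen D)
    (hf : ∀ x ∈ D, f x = 0) {x : Space d} (hx : x ∈ D) :
    A.apply f x = ∫ y, f (x + y) ∂(A.N x) := by
  have h0 : f =ᶠ[𝓝 x] fun _ => (0 : ℝ) := by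
    filter_upwards [hD.mem_nhds hx] with z hz using hf z hz
  have h1 : fderiv ℝ f x = 0 := by rw [h0.fderiv_eq]; simp
  have h2 : iteratedFDeriv ℝ 2 f x = 0 := by
    rw [(h0.iteratedFDeriv ℝ 2).eq_of_nhds]
    simp
  simp [apply, h1, h2, hf x hx]

end Coefficients

/-! ### Measurability along càdlàg paths -/

variable {d : ℕ}

/-- The smallest multiple of `1 / (k + 1)` that is strictly larger than `t`. -/
noncomputable def gridAbove (k : ℕ) (t : ℝ≥0) : ℝ≥0 :=
  ((⌊((k : ℝ≥0) + 1) * t⌋₊ : ℝ≥0) + 1) / ((k : ℝ≥0) + 1)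

theorem lt_gridAbove (k : ℕ) (t : ℝ≥0) : t < gridAbove k t := by
  rw [gridAbove, lt_div_iff₀ (by positivity), mul_comm]
  exact Nat.lt_floor_add_one _

theorem gridAbove_le (k : ℕ) (t : ℝ≥0) : gridAbove k t ≤ t + 1 / ((k : ℝ≥0) + 1) := by
  rw [gridAbove, add_div]
  gcongr
  rw [div_le_iff₀ (by positivity), mul_comm]
  exact Nat.floor_le (by positivity)

theorem tendsto_gridAbove (t : ℝ≥0) : Tendsto (fun k => gridAbove k t) atTop (𝓝 t) := by
  refine tendsto_of_tendsto_of_tendsto_of_le_of_le tendsto_const_nhds ?_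
    (fun k => (lt_gridAbove k t).le) (fun k => gridAbove_le k t)
  simpa using tendsto_const_nhds.add (tendsto_one_div_add_atTop_nhds_zero_nat (𝕜 := ℝ≥0))

theorem measurable_gridAbove (k : ℕ) : Measurable (gridAbove k) := by
  have : Measurable fun t : ℝ≥0 => ⌊((k : ℝ≥0) + 1) * t⌋₊ :=
    Nat.measurable_floor.comp (measurable_const.mul measurable_id)
  exact ((measurable_from_nat (f := fun n => (n : ℝ≥0))).comp this |>.add_const 1).div_const _

theorem Path.tendsto_of_le (ω : Path d) {s : ℕ → ℝ≥0} {t : ℝ≥0} (hs : ∀ k, t ≤ s k)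
    (h : Tendsto s atTop (𝓝 t)) : Tendsto (fun k => ω (s k)) atTop (𝓝 (ω t)) :=
  (ω.2 t).1.tendsto.comp (tendsto_nhdsWithin_iff.2 ⟨h, Eventually.of_forall hs⟩)

/-- The canonical process is jointly measurable in time and path: by right continuity it is the
limit of processes that are constant on grid intervals. -/
theorem measurable_eval : Measurable fun p : Path d × ℝ≥0 => p.1 p.2 := by
  refine measurable_of_tendsto_metrizable (f := fun k (p : Path d × ℝ≥0) =>
    p.1 (gridAbove k p.2)) (fun k => ?_) ?_
  · have h1 : Measurable fun q : Path d × ℕ =>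
        q.1 (((q.2 : ℝ≥0) + 1) / ((k : ℝ≥0) + 1)) :=
      measurable_from_prod_countable_left fun n =>
        measurable_coord (((n : ℝ≥0) + 1) / ((k : ℝ≥0) + 1))
    have h2 : Measurable fun p : Path d × ℝ≥0 => (p.1, ⌊((k : ℝ≥0) + 1) * p.2⌋₊) :=
      measurable_fst.prodMk
        (Nat.measurable_floor.comp (measurable_const.mul measurable_snd))
    exact h1.comp h2
  · rw [tendsto_pi_nhds]
    exact fun p => p.1.tendsto_of_le (fun k => (lt_gridAbove k p.2).le) (tendsto_gridAbove p.2)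

theorem measurable_eval_real :
    Measurable fun p : Path d × ℝ => p.1 p.2.toNNReal :=
  measurable_eval.comp (measurable_fst.prodMk (measurable_real_toNNReal.comp measurable_snd))

theorem measurable_eval_time {τ : Path d → ℝ≥0} (hτ : Measurable τ) :
    Measurable fun ω : Path d => ω (τ ω) :=
  measurable_eval.comp (measurable_id.prodMk hτ)

theorem Path.measurable_comp_real (ω : Path d) : Measurable fun r : ℝ => ω r.toNNReal :=
  measurable_eval_real.comp (measurable_const.prodMk measurable_id)

/-- The subgraph `{(ω, r) | 0 < r < τ(ω)}`. -/
def subgraph (τ : Path d → ℝ≥0) : Set (Path d × ℝ) := {p | p.2 ∈ Ioo (0 : ℝ) (τ p.1)}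

theorem measurableSet_subgraph {τ : Path d → ℝ≥0} (hτ : Measurable τ) :
    MeasurableSet (subgraph τ) := by
  have h : Measurable fun p : Path d × ℝ => (τ p.1 : ℝ) :=
    measurable_coe_nnreal_real.comp (hτ.comp measurable_fst)
  exact (measurableSet_lt measurable_const measurable_snd).inter
    (measurableSet_lt measurable_snd h)

theorem intervalIntegral_eq_integral_indicator (τ : Path d → ℝ≥0) (h : Space d → ℝ) (ω : Path d) :
    ∫ r in (0 : ℝ)..τ ω, h (ω r.toNNReal) =
      ∫ r, (subgraph τ).indicator (fun p => h (p.1 p.2.toNNReal)) (ω, r) := by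
  rw [intervalIntegral.integral_of_le (τ ω).coe_nonneg, integral_Ioc_eq_integral_Ioo,
    ← integral_indicator measurableSet_Ioo]
  rfl

theorem measurable_integral_path {h : Space d → ℝ} (hh : Measurable h) {τ : Path d → ℝ≥0}
    (hτ : Measurable τ) : Measurable fun ω => ∫ r in (0 : ℝ)..τ ω, h (ω r.toNNReal) := by
  simp_rw [intervalIntegral_eq_integral_indicator]
  refine (StronglyMeasurable.integral_prod_right' (ν := volume) ?_).measurable
  exact ((hh.comp measurable_eval_real).indicator (measurableSet_subgraph hτ)).stronglyMeasurable

theorem measurable_lintegral_path {F : Path d × ℝ → ℝ≥0∞} (hF : Measurable F) {τ : Path d → ℝ≥0}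
    (hτ : Measurable τ) : Measurable fun ω => ∫⁻ r in Ioo (0 : ℝ) (τ ω), F (ω, r) := by
  have : ∀ ω, ∫⁻ r in Ioo (0 : ℝ) (τ ω), F (ω, r) = ∫⁻ r, (subgraph τ).indicator F (ω, r) := by
    intro ω
    rw [← lintegral_indicator measurableSet_Ioo]
    rfl
  simp_rw [this]
  exact (hF.indicator (measurableSet_subgraph hτ)).lintegral_prod_right'

theorem intervalIntegrable_path {h : Space d → ℝ} (hh : Measurable h) {C : ℝ}
    (hC : ∀ x, |h x| ≤ C) (ω : Path d) (a b : ℝ) :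
    IntervalIntegrable (fun r : ℝ => h (ω r.toNNReal)) volume a b := by
  refine (intervalIntegrable_const (c := C)).mono_fun
    (hh.comp ω.measurable_comp_real).aestronglyMeasurable (Eventually.of_forall fun r => ?_)
  exact (hC _).trans (le_abs_self C)

theorem abs_integral_path_le {h : Space d → ℝ} {C : ℝ} (hC : ∀ x, |h x| ≤ C) (ω : Path d)
    (t : ℝ≥0) : |∫ r in (0 : ℝ)..t, h (ω r.toNNReal)| ≤ C * t := by
  have := intervalIntegral.norm_integral_le_of_norm_le_const (a := 0) (b := (t : ℝ))
    (f := fun r : ℝ => h (ω r.toNNReal)) (C := C) (fun r _ => hC _)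
  simpa using this

theorem tendsto_integral_path {h : Space d → ℝ} (hh : Measurable h) {C : ℝ}
    (hC : ∀ x, |h x| ≤ C) (ω : Path d) {s : ℕ → ℝ≥0} {t : ℝ≥0} (hs : Tendsto s atTop (𝓝 t)) :
    Tendsto (fun k => ∫ r in (0 : ℝ)..s k, h (ω r.toNNReal)) atTop
      (𝓝 (∫ r in (0 : ℝ)..t, h (ω r.toNNReal))) := by
  have hc := intervalIntegral.continuous_primitive
    (fun a b => intervalIntegrable_path hh hC ω a b) 0
  exact (hc.tendsto (t : ℝ)).comp ((NNReal.tendsto_coe).2 hs)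

/-! ### Optional times and Dynkin's formula -/

/-- A finite optional time: `{τ < s} ∈ ℱ_s` for all `s`, that is, a stopping time of the
right-continuous enlargement of the natural filtration. -/
def IsOptionalTime (τ : Path d → ℝ≥0) : Prop :=
  ∀ s, MeasurableSet[canonicalFiltration d s] {ω | τ ω < s}

theorem IsOptionalTime.measurable {τ : Path d → ℝ≥0} (hτ : IsOptionalTime τ) : Measurable τ :=
  measurable_of_Iio fun s => (canonicalFiltration d).le s _ (hτ s)

/-- Rounding an optional time up to a grid gives a stopping time of the natural filtration. -/
theorem IsOptionalTime.isStoppingTime_gridAbove {τ : Path d → ℝ≥0} (hτ : IsOptionalTime τ)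
    (k : ℕ) (T : ℝ≥0) :
    IsStoppingTime (canonicalFiltration d)
      fun ω => ((min (gridAbove k (τ ω)) T : ℝ≥0) : WithTop ℝ≥0) := by
  intro s
  simp only [WithTop.coe_le_coe, min_le_iff]
  by_cases hT : T ≤ s
  · simp [hT]
  simp only [hT, or_false]
  have hpos : 0 < (k : ℝ≥0) + 1 := by positivity
  have hset : {ω | gridAbove k (τ ω) ≤ s} =
      {ω | τ ω < (⌊s * ((k : ℝ≥0) + 1)⌋₊ : ℝ≥0) / ((k : ℝ≥0) + 1)} := by
    ext ω
    simp only [mem_ofPred_eq]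
    rw [gridAbove, div_le_iff₀ hpos, lt_div_iff₀ hpos, mul_comm (τ ω),
      ← Nat.floor_lt (by positivity), ← Nat.add_one_le_iff, Nat.le_floor_iff (by positivity)]
    push_cast
    rfl
  rw [hset]
  refine (canonicalFiltration d).mono ?_ _ (hτ _)
  rw [div_le_iff₀ hpos]
  exact Nat.floor_le (by positivity)

theorem SolvesMartingaleProblem.ae_eval_zero {A : Coefficients d} {x : Space d}
    {Q : Measure (Path d)} (hQ : SolvesMartingaleProblem A (Measure.dirac x) Q) :
    ∀ᵐ ω ∂Q, ω 0 = x := by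
  have : ∀ᵐ y ∂(Q.map fun ω => ω 0), y = x := by
    rw [hQ.initial]
    simp [ae_dirac_eq]
  exact ae_of_ae_map (measurable_coord 0).aemeasurable this

/-- Dynkin's formula at a bounded optional time. The martingale is sampled at grid valued stopping
times that decrease to `τ`; right continuity of the paths gives the limit. -/
theorem SolvesMartingaleProblem.dynkin {A : Coefficients d} (hA : A.Admissible) {x : Space d}
    {Q : Measure (Path d)} (hQ : SolvesMartingaleProblem A (Measure.dirac x) Q)
    {f : Space d → ℝ} (hf : IsCb2 f) {τ : Path d → ℝ≥0} (hτ : IsOptionalTime τ) {T : ℝ≥0}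
    (hT : ∀ ω, τ ω ≤ T) :
    ∫ ω, f (ω (τ ω)) ∂Q = f x + ∫ ω, (∫ r in (0 : ℝ)..τ ω, A.apply f (ω r.toNNReal)) ∂Q := by
  have := hQ.isProbabilityMeasure
  obtain ⟨C, hC0, hC⟩ := hA.bounded_apply hf
  have hAm := hA.measurable_apply hf
  have hfm : Measurable f := hf.1.continuous.measurable
  obtain ⟨B, hB⟩ := hf.2
  have hB' : ∀ y, |f y| ≤ B := fun y => (hB y).1
  set M : ℝ≥0 → Path d → ℝ := fun t ω =>
    f (ω t) - f (ω 0) - ∫ r in (0 : ℝ)..t, A.apply f (ω r.toNNReal) with hM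
  have hmart : Martingale M (canonicalFiltration d) Q := hQ.martingale f hf
  have hMm : ∀ {σ : Path d → ℝ≥0}, Measurable σ → Measurable fun ω => M (σ ω) ω := by
    intro σ hσ
    exact ((hfm.comp (measurable_eval_time hσ)).sub (hfm.comp (measurable_coord 0))).sub
      (measurable_integral_path hAm hσ)
  have hMb : ∀ t ≤ T, ∀ ω, |M t ω| ≤ B + B + C * T := by
    intro t ht ω
    have h1 := abs_integral_path_le hC ω t
    have h2 : C * (t : ℝ) ≤ C * T := mul_le_mul_of_nonneg_left (by exact_mod_cast ht) hC0
    refine (abs_sub _ _).trans (add_le_add ((abs_sub _ _).trans ?_) (h1.trans h2))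
    exact add_le_add (hB' _) (hB' _)
  let σ : ℕ → Path d → ℝ≥0 := fun k ω => min (gridAbove k (τ ω)) T
  have hσm : ∀ k, Measurable (σ k) := fun k =>
    ((measurable_gridAbove k).comp hτ.measurable).min measurable_const
  have hdisc : ∀ k, ∫ ω, M (σ k ω) ω ∂Q = 0 := by
    intro k
    have hst := hτ.isStoppingTime_gridAbove k T
    have hcount : (range fun ω => ((σ k ω : ℝ≥0) : WithTop ℝ≥0)).Countable := by
      refine (countable_range fun n : ℕ =>
        ((min (((n : ℝ≥0) + 1) / ((k : ℝ≥0) + 1)) T : ℝ≥0) : WithTop ℝ≥0)).mono ?_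
      rintro _ ⟨ω, rfl⟩
      exact ⟨⌊((k : ℝ≥0) + 1) * τ ω⌋₊, rfl⟩
    have hle : ∀ ω, ((σ k ω : ℝ≥0) : WithTop ℝ≥0) ≤ T := fun ω =>
      WithTop.coe_le_coe.2 (min_le_right _ _)
    have h1 := hmart.stoppedValue_ae_eq_condExp_of_le_const_of_countable_range hst hle hcount
    have h2 : ∫ ω, M (σ k ω) ω ∂Q = ∫ ω, M T ω ∂Q := by
      rw [← integral_condExp (hst.measurableSpace_le_of_le hle) (f := M T), ← integral_congr_ae h1]
      rfl
    have h3 := hmart.setIntegral_eq (zero_le (a := T)) (s := univ) MeasurableSet.univ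
    rw [h2]
    simp only [Measure.restrict_univ] at h3
    rw [← h3]
    simp [hM]
  have hlim : Tendsto (fun k => ∫ ω, M (σ k ω) ω ∂Q) atTop (𝓝 (∫ ω, M (τ ω) ω ∂Q)) := by
    refine tendsto_integral_of_dominated_convergence (fun _ => B + B + C * T)
      (fun k => (hMm (hσm k)).aestronglyMeasurable) (integrable_const _)
      (fun k => Eventually.of_forall fun ω => hMb _ (min_le_right _ _) ω)
      (Eventually.of_forall fun ω => ?_)
    have hσlim : Tendsto (fun k => σ k ω) atTop (𝓝 (τ ω)) := by
      have := (tendsto_gridAbove (τ ω)).min (tendsto_const_nhds (x := T))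
      rwa [min_eq_left (hT ω)] at this
    have h1 := ω.tendsto_of_le (fun k => le_min (lt_gridAbove k (τ ω)).le (hT ω)) hσlim
    exact (((hf.1.continuous.tendsto _).comp h1).sub tendsto_const_nhds).sub
      (tendsto_integral_path hAm hC ω hσlim)
  simp only [hdisc] at hlim
  have hzero : ∫ ω, M (τ ω) ω ∂Q = 0 := (tendsto_nhds_unique hlim tendsto_const_nhds)
  have hx := hQ.ae_eval_zero
  have i1 : Integrable (fun ω : Path d => f (ω (τ ω))) Q :=
    Integrable.of_bound (hfm.comp (measurable_eval_time hτ.measurable)).aestronglyMeasurable B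
      (Eventually.of_forall fun ω => hB' _)
  have i2 : Integrable (fun ω => ∫ r in (0 : ℝ)..τ ω, A.apply f (ω r.toNNReal)) Q := by
    refine Integrable.of_bound (measurable_integral_path hAm hτ.measurable).aestronglyMeasurable
      (C * T) (Eventually.of_forall fun ω => (abs_integral_path_le hC ω _).trans ?_)
    exact mul_le_mul_of_nonneg_left (by exact_mod_cast hT ω) hC0
  have hcongr : ∫ ω, M (τ ω) ω ∂Q =
      ∫ ω, (f (ω (τ ω)) - f x - ∫ r in (0 : ℝ)..τ ω, A.apply f (ω r.toNNReal)) ∂Q := by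
    refine integral_congr_ae ?_
    filter_upwards [hx] with ω hω
    simp only [hM, hω]
  have e1 := integral_sub (i1.sub (integrable_const (f x))) i2
  have e2 := integral_sub i1 (integrable_const (μ := Q) (f x))
  have e3 : ∫ _, f x ∂Q = f x := by simp
  have e4 := (hzero.symm.trans hcongr).trans (e1.trans (congrArg₂ _ e2 rfl))
  rw [e3] at e4
  linarith

/-! ### Hitting times of open sets -/

/-- The infimum of the times `t ≥ 0` at which the path is in `U`, capped at `T`. Time `0` is
included, unlike in `exitTime`. -/
noncomputable def hit (U : Set (Space d)) (T : ℝ≥0) (ω : Path d) : ℝ≥0 :=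
  sInf {t : ℝ≥0 | ω t ∈ U ∨ T ≤ t}

theorem hit_le (U : Set (Space d)) (T : ℝ≥0) (ω : Path d) : hit U T ω ≤ T :=
  csInf_le (OrderBot.bddBelow _) (Or.inr le_rfl)

theorem hit_le_of_mem {U : Set (Space d)} (T : ℝ≥0) {ω : Path d} {t : ℝ≥0} (h : ω t ∈ U) :
    hit U T ω ≤ t :=
  csInf_le (OrderBot.bddBelow _) (Or.inl h)

theorem hit_anti {U V : Set (Space d)} (h : V ⊆ U) (T : ℝ≥0) (ω : Path d) :
    hit U T ω ≤ hit V T ω :=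
  csInf_le_csInf (OrderBot.bddBelow _) ⟨T, Or.inr le_rfl⟩ fun _ => Or.imp_left fun hr => h hr

theorem exists_Ico_mem (ω : Path d) {U : Set (Space d)} (hU : IsOpen U) {t : ℝ≥0} (h : ω t ∈ U) :
    ∃ u, t < u ∧ ∀ r, t ≤ r → r < u → ω r ∈ U := by
  have h1 : {r | ω r ∈ U} ∈ 𝓝[≥] t := (ω.2 t).1 (hU.mem_nhds h)
  obtain ⟨u, hu, hsub⟩ := (mem_nhdsGE_iff_exists_Ico_subset).1 h1
  exact ⟨u, hu, fun r h2 h3 => hsub ⟨h2, h3⟩⟩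

theorem eval_hit_mem_closure {U : Set (Space d)} {T : ℝ≥0} {ω : Path d} (h : hit U T ω < T) :
    ω (hit U T ω) ∈ closure U := by
  by_contra hc
  obtain ⟨u, hu, hsub⟩ := exists_Ico_mem ω isClosed_closure.isOpen_compl hc
  obtain ⟨s, hs, hlt⟩ := exists_lt_of_csInf_lt (s := {t : ℝ≥0 | ω t ∈ U ∨ T ≤ t})
    ⟨T, Or.inr le_rfl⟩ (lt_min hu h)
  rcases hs with hs | hs
  · exact hsub s (hit_le_of_mem T hs) (hlt.trans_le (min_le_left _ _)) (subset_closure hs)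
  · exact absurd (hlt.trans_le (min_le_right _ _)) (not_lt.2 hs)

theorem measurable_coord_filtration {s t : ℝ≥0} (h : s ≤ t) :
    Measurable[canonicalFiltration d t] fun ω : Path d => ω s :=
  (((Filtration.stronglyAdapted_natural (u := fun (t : ℝ≥0) (ω : Path d) => ω t)
    fun t => (measurable_coord t).stronglyMeasurable) s).measurable).mono
      ((canonicalFiltration d).mono h) le_rfl

theorem isOptionalTime_hit {U : Set (Space d)} (hU : IsOpen U) (T : ℝ≥0) :
    IsOptionalTime (hit U T) := by
  intro s
  by_cases hT : T < s
  · have : {ω : Path d | hit U T ω < s} = univ :=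
      eq_univ_of_forall fun ω => (hit_le U T ω).trans_lt hT
    rw [this]
    exact MeasurableSet.univ
  have hset : {ω : Path d | hit U T ω < s} =
      ⋃ n : ℕ, ⋃ _ : TopologicalSpace.denseSeq ℝ≥0 n < s,
        {ω : Path d | ω (TopologicalSpace.denseSeq ℝ≥0 n) ∈ U} := by
    ext ω
    simp only [mem_ofPred_eq, mem_iUnion, exists_prop]
    constructor
    · intro h
      obtain ⟨t, ht, hlt⟩ := exists_lt_of_csInf_lt (s := {t : ℝ≥0 | ω t ∈ U ∨ T ≤ t})
        ⟨T, Or.inr le_rfl⟩ h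
      rcases ht with ht | ht
      · obtain ⟨u, hu, hsub⟩ := exists_Ico_mem ω hU ht
        obtain ⟨n, hn⟩ := (TopologicalSpace.denseRange_denseSeq ℝ≥0).exists_mem_open
          (isOpen_Ioo (a := t) (b := min u s)) (nonempty_Ioo.2 (lt_min hu hlt))
        exact ⟨n, hn.2.trans_le (min_le_right _ _),
          hsub _ hn.1.le (hn.2.trans_le (min_le_left _ _))⟩
      · exact absurd (ht.trans_lt hlt) hT
    · rintro ⟨n, hn, hmem⟩
      exact (hit_le_of_mem T hmem).trans_lt hn
  rw [hset]
  exact MeasurableSet.iUnion fun n => MeasurableSet.iUnion fun hn =>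
    measurable_coord_filtration hn.le hU.measurableSet

/-- The supremum of a bounded sequence of optional times is an optional time. -/
theorem IsOptionalTime.iSup {H : ℕ → Path d → ℝ≥0} (hH : ∀ n, IsOptionalTime (H n)) {T : ℝ≥0}
    (hT : ∀ n ω, H n ω ≤ T) : IsOptionalTime fun ω => ⨆ n, H n ω := by
  intro s
  have hb : ∀ ω, BddAbove (range fun n => H n ω) := fun ω =>
    ⟨T, by rintro _ ⟨n, rfl⟩; exact hT n ω⟩
  have hset : {ω : Path d | ⨆ n, H n ω < s} =
      ⋃ m : ℕ, ⋃ _ : TopologicalSpace.denseSeq ℝ≥0 m < s,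
        ⋂ n, {ω : Path d | H n ω < TopologicalSpace.denseSeq ℝ≥0 m} := by
    ext ω
    simp only [mem_ofPred_eq, mem_iUnion, mem_iInter, exists_prop]
    constructor
    · intro h
      obtain ⟨m, hm⟩ := (TopologicalSpace.denseRange_denseSeq ℝ≥0).exists_mem_open
        (isOpen_Ioo (a := ⨆ n, H n ω) (b := s)) (nonempty_Ioo.2 h)
      exact ⟨m, hm.2, fun n => (le_ciSup (hb ω) n).trans_lt hm.1⟩
    · rintro ⟨m, hm, h⟩
      exact (ciSup_le fun n => (h n).le).trans_lt hm
  rw [hset]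
  exact MeasurableSet.iUnion fun m => MeasurableSet.iUnion fun hm =>
    MeasurableSet.iInter fun n => (canonicalFiltration d).mono hm.le _ (hH n _)

/-! ### The exit time -/

theorem coe_exitTimeMin (D : Set (Space d)) (T : ℝ≥0) (ω : Path d) :
    (exitTimeMin D T ω : ℝ≥0∞) = min (exitTime D ω) T :=
  ENNReal.coe_toNNReal (ne_top_of_le_ne_top ENNReal.coe_ne_top (min_le_right _ _))

theorem exitTimeMin_le (D : Set (Space d)) (T : ℝ≥0) (ω : Path d) : exitTimeMin D T ω ≤ T := by
  rw [← ENNReal.coe_le_coe, coe_exitTimeMin]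
  exact min_le_right _ _

theorem exitTime_le {D : Set (Space d)} {ω : Path d} {t : ℝ≥0} (ht : 0 < t) (h : ω t ∉ D) :
    exitTime D ω ≤ t :=
  sInf_le ⟨t, ht, h, rfl⟩

theorem mem_of_lt_exitTime {D : Set (Space d)} {ω : Path d} {t : ℝ≥0} (ht : 0 < t)
    (h : (t : ℝ≥0∞) < exitTime D ω) : ω t ∈ D := by
  by_contra hc
  exact absurd (exitTime_le ht hc) (not_le.2 h)

theorem mem_of_lt_exitTimeMin {D : Set (Space d)} {T : ℝ≥0} {ω : Path d} {r : ℝ}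
    (hr : r ∈ Ioo (0 : ℝ) (exitTimeMin D T ω)) : ω r.toNNReal ∈ D := by
  refine mem_of_lt_exitTime (Real.toNNReal_pos.2 hr.1) ?_
  have h1 : r.toNNReal < exitTimeMin D T ω := by
    rw [Real.toNNReal_lt_iff_lt_coe hr.1.le]
    exact hr.2
  have h2 : (r.toNNReal : ℝ≥0∞) < exitTimeMin D T ω := ENNReal.coe_lt_coe.2 h1
  rw [coe_exitTimeMin] at h2
  exact h2.trans_le (min_le_left _ _)

/-- The form of quasi-left-continuity that is needed: let `H n` be the hitting times of decreasing
open sets, capped at `T`, and `σ` their supremum. If `f ≥ 0` becomes small on these sets, then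
`f (X_σ) = 0` on `{σ < T}`. Indeed `𝔼 f (X_{H n}) → 𝔼 f (X_σ)` by Dynkin's formula, whereas
`f (X_{H n}) → 0` on the event that `H n < T` for all `n`, and `H n = σ = T` eventually off it. -/
theorem SolvesMartingaleProblem.ae_eq_zero_at_limit {A : Coefficients d} (hA : A.Admissible)
    {x : Space d} {Q : Measure (Path d)} (hQ : SolvesMartingaleProblem A (Measure.dirac x) Q)
    {U : ℕ → Set (Space d)} (hU : ∀ n, IsOpen (U n)) (hanti : Antitone U) (T : ℝ≥0)
    {f : Space d → ℝ} (hf : IsCb2 f) (hf0 : ∀ y, 0 ≤ f y) {ε : ℕ → ℝ}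
    (hε : Tendsto ε atTop (𝓝 0)) (hfU : ∀ᶠ n in atTop, ∀ y ∈ closure (U n), f y ≤ ε n) :
    ∀ᵐ ω ∂Q, (⨆ n, hit (U n) T ω) < T → f (ω (⨆ n, hit (U n) T ω)) = 0 := by
  have := hQ.isProbabilityMeasure
  set H : ℕ → Path d → ℝ≥0 := fun n ω => hit (U n) T ω with hH
  set σ : Path d → ℝ≥0 := fun ω => ⨆ n, H n ω with hσ
  have hHT : ∀ n ω, H n ω ≤ T := fun n ω => hit_le _ _ _
  have hHo : ∀ n, IsOptionalTime (H n) := fun n => isOptionalTime_hit (hU n) T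
  have hσo : IsOptionalTime σ := IsOptionalTime.iSup hHo hHT
  have hb : ∀ ω, BddAbove (range fun n => H n ω) := fun ω =>
    ⟨T, by rintro _ ⟨n, rfl⟩; exact hHT n ω⟩
  have hσT : ∀ ω, σ ω ≤ T := fun ω => ciSup_le fun n => hHT n ω
  have hmono : ∀ ω, Monotone fun n => H n ω := fun ω m n h => hit_anti (hanti h) T ω
  have hlim : ∀ ω, Tendsto (fun n => H n ω) atTop (𝓝 (σ ω)) := fun ω =>
    tendsto_atTop_ciSup (hmono ω) (hb ω)
  obtain ⟨C, hC0, hC⟩ := hA.bounded_apply hf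
  have hAm := hA.measurable_apply hf
  have hfm : Measurable f := hf.1.continuous.measurable
  obtain ⟨B, hB⟩ := hf.2
  have hB' : ∀ y, |f y| ≤ B := fun y => (hB y).1
  have hfX : ∀ {τ : Path d → ℝ≥0}, IsOptionalTime τ → Measurable fun ω : Path d => f (ω (τ ω)) :=
    fun hτ => hfm.comp (measurable_eval_time hτ.measurable)
  -- Dynkin's formula: the expectations converge to the expectation at `σ`.
  have hlim1 : Tendsto (fun n => ∫ ω, f (ω (H n ω)) ∂Q) atTop (𝓝 (∫ ω, f (ω (σ ω)) ∂Q)) := by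
    have e1 : (fun n => ∫ ω, f (ω (H n ω)) ∂Q) = fun n =>
        f x + ∫ ω, (∫ r in (0 : ℝ)..H n ω, A.apply f (ω r.toNNReal)) ∂Q :=
      funext fun n => hQ.dynkin hA hf (hHo n) (hHT n)
    rw [e1, hQ.dynkin hA hf hσo hσT]
    refine tendsto_const_nhds.add ?_
    refine tendsto_integral_of_dominated_convergence (fun _ => C * T)
      (fun n => (measurable_integral_path hAm (hHo n).measurable).aestronglyMeasurable)
      (integrable_const _) (fun n => Eventually.of_forall fun ω => ?_)
      (Eventually.of_forall fun ω => tendsto_integral_path hAm hC ω (hlim ω))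
    refine (abs_integral_path_le hC ω _).trans ?_
    exact mul_le_mul_of_nonneg_left (by exact_mod_cast hHT n ω) hC0
  let S : Set (Path d) := {ω | ∀ n, H n ω < T}
  have hSm : MeasurableSet S := by
    have : S = ⋂ n, {ω | H n ω < T} := by ext ω; simp [S]
    rw [this]
    exact MeasurableSet.iInter fun n => measurableSet_lt (hHo n).measurable measurable_const
  have hlim2 : Tendsto (fun n => ∫ ω, f (ω (H n ω)) ∂Q) atTop
      (𝓝 (∫ ω, Sᶜ.indicator (fun ω => f (ω (σ ω))) ω ∂Q)) := by
    refine tendsto_integral_of_dominated_convergence (fun _ => B)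
      (fun n => (hfX (hHo n)).aestronglyMeasurable) (integrable_const _)
      (fun n => Eventually.of_forall fun ω => hB' _) (Eventually.of_forall fun ω => ?_)
    by_cases hω : ω ∈ S
    · rw [indicator_of_notMem (by simpa using hω)]
      refine tendsto_of_tendsto_of_tendsto_of_le_of_le' tendsto_const_nhds hε
        (Eventually.of_forall fun n => hf0 _) ?_
      filter_upwards [hfU] with n hn
      exact hn _ (eval_hit_mem_closure (hω n))
    · rw [indicator_of_mem (by simpa using hω)]
      have : ∃ n, T ≤ H n ω := by simpa [S] using hω
      obtain ⟨n, hn⟩ := this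
      refine tendsto_const_nhds.congr' ?_
      filter_upwards [eventually_ge_atTop n] with m hm
      have h1 : H m ω = T := le_antisymm (hHT m ω) (hn.trans (hmono ω hm))
      have h2 : σ ω = T := le_antisymm (hσT ω) (h1 ▸ le_ciSup (hb ω) m)
      rw [h1, h2]
  have hint : Integrable (fun ω => f (ω (σ ω))) Q :=
    Integrable.of_bound (hfX hσo).aestronglyMeasurable B (Eventually.of_forall fun ω => hB' _)
  have hzero : ∫ ω in S, f (ω (σ ω)) ∂Q = 0 := by
    have h1 := tendsto_nhds_unique hlim1 hlim2
    rw [integral_indicator hSm.compl] at h1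
    have h2 := integral_add_compl hSm hint
    linarith
  rw [integral_eq_zero_iff_of_nonneg (fun ω => hf0 _) hint.integrableOn] at hzero
  have h3 := (ae_restrict_iff' hSm).1 hzero
  filter_upwards [h3] with ω hω hlt
  exact hω fun n => (le_ciSup (hb ω) n).trans_lt hlt

/-- The exit time itself need not be measurable for the natural filtration, as `Dᶜ` is closed and a
path may approach `Dᶜ` from the left without hitting it. Almost surely it agrees with the limit of
the hitting times of open neighbourhoods of `Dᶜ`. -/
theorem SolvesMartingaleProblem.exists_optionalTime_ae_eq_exitTimeMin {A : Coefficients d}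
    (hA : A.Admissible) {x : Space d} {Q : Measure (Path d)}
    (hQ : SolvesMartingaleProblem A (Measure.dirac x) Q) {D : Set (Space d)} (hD : IsOpen D)
    (hx : x ∈ D) (T : ℝ≥0) :
    ∃ σ : Path d → ℝ≥0, IsOptionalTime σ ∧ (∀ ω, σ ω ≤ T) ∧
      ∀ᵐ ω ∂Q, exitTimeMin D T ω = σ ω := by
  choose f hfs hf hf01 using fun R : ℕ =>
    exists_smooth_bump_support (hD.inter (Metric.isOpen_ball (x := (0 : Space d)) (ε := R)))
      (Metric.isBounded_ball.subset inter_subset_right)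
  let U : ℕ → Set (Space d) := fun n => ⋂ R ∈ Finset.range (n + 1), {y | f R y < 1 / ((n : ℝ) + 1)}
  have hUo : ∀ n, IsOpen (U n) := fun n => isOpen_biInter_finset fun R _ =>
    isOpen_lt (hf R).1.continuous continuous_const
  have hanti : Antitone U := by
    intro m n hmn y hy
    simp only [U, mem_iInter, Finset.mem_range, mem_ofPred_eq] at hy ⊢
    intro R hR
    refine (hy R (by omega)).trans_le ?_
    exact one_div_le_one_div_of_le (by positivity) (by exact_mod_cast Nat.succ_le_succ hmn)
  have hUD : ∀ n, Dᶜ ⊆ U n := by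
    intro n y hy
    simp only [U, mem_iInter, mem_ofPred_eq]
    intro R _
    have : f R y = 0 := by
      by_contra h
      have h1 : y ∈ (f R).support := h
      rw [hfs R] at h1
      exact hy h1.1
    rw [this]
    positivity
  have hUf : ∀ R, ∀ᶠ n : ℕ in atTop, ∀ y ∈ closure (U n), f R y ≤ 1 / ((n : ℝ) + 1) := by
    intro R
    filter_upwards [eventually_ge_atTop R] with n hn
    have hc : IsClosed {y | f R y ≤ 1 / ((n : ℝ) + 1)} :=
      isClosed_le (hf R).1.continuous continuous_const
    refine closure_minimal (fun y hy => ?_) hc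
    simp only [U, mem_iInter, Finset.mem_range, mem_ofPred_eq] at hy
    exact (hy R (by omega)).le
  have hb : ∀ ω : Path d, BddAbove (range fun n => hit (U n) T ω) := fun ω =>
    ⟨T, by rintro _ ⟨n, rfl⟩; exact hit_le _ _ _⟩
  refine ⟨fun ω => ⨆ n, hit (U n) T ω,
    IsOptionalTime.iSup (fun n => isOptionalTime_hit (hUo n) T) (fun n ω => hit_le _ _ _),
    fun ω => ciSup_le fun n => hit_le _ _ _, ?_⟩
  have hx0 : ∀ᵐ ω ∂Q, ω 0 = x := hQ.ae_eval_zero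
  have hzero : ∀ᵐ ω ∂Q, ∀ R, (⨆ n, hit (U n) T ω) < T → f R (ω (⨆ n, hit (U n) T ω)) = 0 :=
    ae_all_iff.2 fun R => hQ.ae_eq_zero_at_limit hA hUo hanti T (hf R) (fun y => (hf01 R y).1)
      tendsto_one_div_add_atTop_nhds_zero_nat (hUf R)
  filter_upwards [hx0, hzero] with ω h0 hω
  set s : ℝ≥0 := ⨆ n, hit (U n) T ω with hs
  refine le_antisymm ?_ (ciSup_le fun n => ?_)
  · rcases lt_or_ge s T with hlt | hge
    · have hsD : ω s ∉ D := by
        intro hmem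
        obtain ⟨R, hR⟩ := exists_nat_gt ‖ω s‖
        have h1 : ω s ∈ (f R).support := by
          rw [hfs R]
          exact ⟨hmem, by simpa using hR⟩
        exact h1 (hω R hlt)
      have hspos : 0 < s := by
        rw [pos_iff_ne_zero]
        intro h
        rw [h, h0] at hsD
        exact hsD hx
      rw [← ENNReal.coe_le_coe, coe_exitTimeMin]
      exact (min_le_left _ _).trans (exitTime_le hspos hsD)
    · exact (exitTimeMin_le D T ω).trans hge
  · rw [← ENNReal.coe_le_coe, coe_exitTimeMin]
    refine le_min (le_sInf ?_) (ENNReal.coe_le_coe.2 (hit_le _ _ _))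
    rintro _ ⟨t, -, ht, rfl⟩
    exact ENNReal.coe_le_coe.2 (hit_le_of_mem T (hUD n ht))

/-! ### The law of the exit position -/

/-- The occupation measure `B ↦ 𝔼 ∫₀^τ 1_B(X_r) dr` of the canonical process up to time `τ`. -/
noncomputable def occupation (Q : Measure (Path d)) (τ : Path d → ℝ≥0) : Measure (Space d) :=
  ((Q.prod volume).restrict (subgraph τ)).map fun p : Path d × ℝ => p.1 p.2.toNNReal

theorem lintegral_occupation {Q : Measure (Path d)} [SFinite Q] {τ : Path d → ℝ≥0}
    (hτ : Measurable τ) {h : Space d → ℝ≥0∞} (hh : Measurable h) :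
    ∫⁻ y, h y ∂(occupation Q τ) = ∫⁻ ω, (∫⁻ r in Ioo (0 : ℝ) (τ ω), h (ω r.toNNReal)) ∂Q := by
  have hm : Measurable fun p : Path d × ℝ => h (p.1 p.2.toNNReal) :=
    hh.comp measurable_eval_real
  rw [occupation, lintegral_map hh measurable_eval_real,
    ← lintegral_indicator (measurableSet_subgraph hτ),
    lintegral_prod _ (hm.indicator (measurableSet_subgraph hτ)).aemeasurable]
  refine lintegral_congr fun ω => ?_
  rw [← lintegral_indicator measurableSet_Ioo]
  rfl

theorem isFiniteMeasure_occupation {Q : Measure (Path d)} [IsProbabilityMeasure Q]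
    {τ : Path d → ℝ≥0} (hτ : Measurable τ) {T : ℝ≥0} (hT : ∀ ω, τ ω ≤ T) :
    IsFiniteMeasure (occupation Q τ) := by
  refine ⟨?_⟩
  have h := lintegral_occupation (Q := Q) hτ (h := fun _ => 1) measurable_const
  simp only [lintegral_const, Measure.restrict_apply MeasurableSet.univ, univ_inter, one_mul,
    Real.volume_Ioo, sub_zero] at h
  rw [h]
  calc ∫⁻ ω, ENNReal.ofReal (τ ω) ∂Q ≤ ∫⁻ _, (T : ℝ≥0∞) ∂Q := by
        refine lintegral_mono fun ω => ?_
        rw [ENNReal.ofReal_coe_nnreal]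
        exact ENNReal.coe_le_coe.2 (hT ω)
    _ < ⊤ := by simp

theorem integral_occupation {Q : Measure (Path d)} [IsProbabilityMeasure Q] {τ : Path d → ℝ≥0}
    (hτ : Measurable τ) {T : ℝ≥0} (hT : ∀ ω, τ ω ≤ T) {h : Space d → ℝ} (hh : Measurable h)
    {C : ℝ} (hC : ∀ y, |h y| ≤ C) :
    ∫ y, h y ∂(occupation Q τ) = ∫ ω, (∫ r in (0 : ℝ)..τ ω, h (ω r.toNNReal)) ∂Q := by
  have := isFiniteMeasure_occupation (Q := Q) hτ hT
  have hint : Integrable h (occupation Q τ) :=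
    Integrable.of_bound hh.aestronglyMeasurable C (Eventually.of_forall hC)
  have hint' : Integrable (fun p : Path d × ℝ => h (p.1 p.2.toNNReal))
      ((Q.prod volume).restrict (subgraph τ)) :=
    hint.comp_measurable measurable_eval_real
  have hint2 := (integrable_indicator_iff (measurableSet_subgraph hτ)).2 hint'
  rw [occupation, integral_map measurable_eval_real.aemeasurable hh.aestronglyMeasurable,
    ← integral_indicator (measurableSet_subgraph hτ), integral_prod _ hint2]
  exact integral_congr_ae (Eventually.of_forall fun ω =>
    (intervalIntegral_eq_integral_indicator τ h ω).symm)

theorem ae_occupation_mem {Q : Measure (Path d)} [SFinite Q] {τ : Path d → ℝ≥0}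
    (hτ : Measurable τ) {D : Set (Space d)} (hD : MeasurableSet D)
    (h : ∀ᵐ ω ∂Q, ∀ r ∈ Ioo (0 : ℝ) (τ ω), ω r.toNNReal ∈ D) :
    ∀ᵐ y ∂(occupation Q τ), y ∈ D := by
  have h1 := lintegral_occupation (Q := Q) hτ (h := Dᶜ.indicator 1)
    (measurable_one.indicator hD.compl)
  rw [lintegral_indicator_one hD.compl] at h1
  have h2 : ∫⁻ ω, (∫⁻ r in Ioo (0 : ℝ) (τ ω), (Dᶜ).indicator 1 (ω r.toNNReal)) ∂Q = 0 := by
    rw [lintegral_eq_zero_of_ae_eq_zero]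
    filter_upwards [h] with ω hω
    refine setLIntegral_eq_zero measurableSet_Ioo fun r hr => ?_
    simp [hω r hr]
  rw [h2] at h1
  exact h1

theorem ofReal_integral_le_lintegral {α : Type*} [MeasurableSpace α] {μ : Measure α} {f : α → ℝ}
    (hf : AEStronglyMeasurable f μ) (h0 : ∀ x, 0 ≤ f x) :
    ENNReal.ofReal (∫ x, f x ∂μ) ≤ ∫⁻ x, ENNReal.ofReal (f x) ∂μ := by
  rw [integral_eq_lintegral_of_nonneg_ae (Eventually.of_forall h0) hf]
  exact ENNReal.ofReal_toReal_le

/-- One half of the Lévy system formula: a bounded open set off `D` is reached at time `σ` with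
probability at most `𝔼 ∫₀^σ N(X_r, V - X_r) dr`. -/
theorem SolvesMartingaleProblem.measure_eval_mem_open_le {A : Coefficients d} (hA : A.Admissible)
    {x : Space d} {Q : Measure (Path d)} (hQ : SolvesMartingaleProblem A (Measure.dirac x) Q)
    {D : Set (Space d)} (hD : IsOpen D) (hx : x ∈ D) {σ : Path d → ℝ≥0} (hσ : IsOptionalTime σ)
    {T : ℝ≥0} (hσT : ∀ ω, σ ω ≤ T) (hocc : ∀ᵐ y ∂(occupation Q σ), y ∈ D) {V : Set (Space d)}
    (hV : IsOpen V) (hVb : Bornology.IsBounded V) (hVD : Disjoint V D) :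
    Q {ω | ω (σ ω) ∈ V} ≤ ∫⁻ y, A.N y {z | y + z ∈ V} ∂(occupation Q σ) := by
  have := hQ.isProbabilityMeasure
  have := hA.isSFiniteKernel
  obtain ⟨f, hf, hf01, hfV, hflim⟩ := exists_smooth_tendsto_indicator hV hVb
  have hev := measurable_eval_time hσ.measurable
  have hle : ∀ n, ∫⁻ ω, ENNReal.ofReal (f n (ω (σ ω))) ∂Q
      ≤ ∫⁻ y, A.N y {z | y + z ∈ V} ∂(occupation Q σ) := by
    intro n
    have hfm : Measurable (f n) := (hf n).1.continuous.measurable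
    obtain ⟨C, -, hC⟩ := hA.bounded_apply (hf n)
    have hfD : ∀ y ∈ D, f n y = 0 := fun y hy =>
      hfV n y fun h => hVD.le_bot ⟨h, hy⟩
    have hint : Integrable (fun ω : Path d => f n (ω (σ ω))) Q :=
      Integrable.of_bound (hfm.comp hev).aestronglyMeasurable 1
        (Eventually.of_forall fun ω => by
          rw [Real.norm_of_nonneg (hf01 n _).1]; exact (hf01 n _).2)
    have hjm : StronglyMeasurable fun y => ∫ z, f n (y + z) ∂(A.N y) :=
      StronglyMeasurable.integral_kernel_prod_right' (f := fun p : Space d × Space d =>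
        f n (p.1 + p.2)) (hfm.comp (measurable_fst.add measurable_snd)).stronglyMeasurable
    rw [← ofReal_integral_eq_lintegral_ofReal hint (Eventually.of_forall fun ω => (hf01 n _).1),
      hQ.dynkin hA (hf n) hσ hσT, hfD x hx, zero_add,
      ← integral_occupation hσ.measurable hσT (hA.measurable_apply (hf n)) hC]
    have hae : ∫ y, A.apply (f n) y ∂(occupation Q σ)
        = ∫ y, (∫ z, f n (y + z) ∂(A.N y)) ∂(occupation Q σ) := by
      refine integral_congr_ae ?_
      filter_upwards [hocc] with y hy using Coefficients.apply_eq_of_eqOn_zero hD hfD hy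
    rw [hae]
    refine (ofReal_integral_le_lintegral hjm.aestronglyMeasurable
      fun y => integral_nonneg fun z => (hf01 n _).1).trans (lintegral_mono fun y => ?_)
    have hVm : MeasurableSet {z | y + z ∈ V} :=
      (measurable_const.add measurable_id) hV.measurableSet
    refine (ofReal_integral_le_lintegral
      (hfm.comp (measurable_const.add measurable_id)).aestronglyMeasurable
      fun z => (hf01 n _).1).trans ?_
    rw [← lintegral_indicator_one hVm]
    refine lintegral_mono fun z => ?_
    by_cases hz : y + z ∈ V
    · rw [indicator_of_mem (by exact hz)]
      simpa using ENNReal.ofReal_le_ofReal (hf01 n (y + z)).2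
    · simp [hfV n _ hz]
  have hSm : MeasurableSet {ω : Path d | ω (σ ω) ∈ V} := hev hV.measurableSet
  refine le_of_tendsto' (x := atTop) ?_ hle
  rw [← lintegral_indicator_one hSm]
  refine tendsto_lintegral_of_dominated_convergence (fun _ => 1)
    (fun n => (((hf n).1.continuous.measurable).comp hev).ennreal_ofReal)
    (fun n => Eventually.of_forall fun ω => ?_) (by simp) (Eventually.of_forall fun ω => ?_)
  · simpa using ENNReal.ofReal_le_ofReal (hf01 n (ω (σ ω))).2
  · by_cases hω : ω (σ ω) ∈ V
    · rw [indicator_of_mem (by exact hω)]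
      simpa using ENNReal.tendsto_ofReal (hflim _ hω)
    · rw [indicator_of_notMem (by exact hω)]
      simp [hfV _ _ hω]

/-- At time `σ` the process is almost surely not in a Borel set off `closure D` that cannot be
reached by a jump from `D`, provided that it stays in `D` before `σ`. -/
theorem SolvesMartingaleProblem.ae_eval_notMem {A : Coefficients d} (hA : A.Admissible)
    {x : Space d} {Q : Measure (Path d)} (hQ : SolvesMartingaleProblem A (Measure.dirac x) Q)
    {D : Set (Space d)} (hD : IsOpen D) (hx : x ∈ D) {σ : Path d → ℝ≥0} (hσ : IsOptionalTime σ)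
    {T : ℝ≥0} (hσT : ∀ ω, σ ω ≤ T) (hocc : ∀ᵐ y ∂(occupation Q σ), y ∈ D) {G : Set (Space d)}
    (hG : MeasurableSet G) (hGD : Disjoint G (closure D))
    (hGN : ∀ y ∈ D, A.N y {z | y + z ∈ G} = 0) :
    ∀ᵐ ω ∂Q, ω (σ ω) ∉ G := by
  have := hQ.isProbabilityMeasure
  have := hA.isSFiniteKernel
  have := isFiniteMeasure_occupation (Q := Q) hσ.measurable hσT
  set η := occupation Q σ with hη
  have hadd : Measurable fun p : Space d × Space d => p.1 + p.2 :=
    measurable_fst.add measurable_snd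
  -- `κ B = 𝔼 ∫₀^σ N(X_r, B - X_r) dr`
  let κ : Measure (Space d) := (η ⊗ₘ A.N).map fun p => p.1 + p.2
  have hκ : ∀ {B : Set (Space d)}, MeasurableSet B →
      κ B = ∫⁻ y, A.N y {z | y + z ∈ B} ∂η := by
    intro B hB
    rw [Measure.map_apply hadd hB, Measure.compProd_apply (hadd hB)]
    rfl
  have hκG : κ G = 0 := by
    rw [hκ hG, lintegral_eq_zero_of_ae_eq_zero]
    filter_upwards [hocc] with y hy using hGN y hy
  let W : ℕ → Set (Space d) := fun k => {z | 1 / ((k : ℝ) + 1) < Metric.infDist z D} ∩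
    Metric.ball 0 k
  have hWo : ∀ k, IsOpen (W k) := fun k =>
    (isOpen_lt continuous_const (Metric.continuous_infDist_pt D)).inter Metric.isOpen_ball
  have hWD : ∀ k, Disjoint (W k) D := by
    intro k
    rw [Set.disjoint_left]
    intro z hz hzD
    have h1 : 1 / ((k : ℝ) + 1) < Metric.infDist z D := hz.1
    rw [Metric.infDist_zero_of_mem hzD] at h1
    exact absurd h1 (not_lt.2 (by positivity))
  have hWfin : ∀ k, κ (W k) < ⊤ := by
    intro k
    obtain ⟨K, hK, hN⟩ := hA.exists_tail_bound (ε := 1 / ((k : ℝ) + 1)) (by positivity)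
    rw [hκ (hWo k).measurableSet]
    calc ∫⁻ y, A.N y {z | y + z ∈ W k} ∂η ≤ ∫⁻ _, K ∂η := by
          refine lintegral_mono_ae ?_
          filter_upwards [hocc] with y hy
          refine (measure_mono fun z hz => ?_).trans (hN y)
          have h1 : 1 / ((k : ℝ) + 1) < Metric.infDist (y + z) D := hz.1
          have h2 := Metric.infDist_le_dist_of_mem (x := y + z) hy
          rw [dist_self_add_left] at h2
          exact (h1.trans_le h2).le
      _ < ⊤ := by
          rw [lintegral_const]
          exact ENNReal.mul_lt_top hK (measure_lt_top _ _)
  -- On `W k` the measure `κ` is finite, hence outer regular.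
  have hk : ∀ k, Q {ω | ω (σ ω) ∈ G ∩ W k} = 0 := by
    intro k
    have : IsFiniteMeasure (κ.restrict (W k)) := ⟨by simpa using hWfin k⟩
    refine le_antisymm (le_of_forall_gt fun ε hε => ?_) bot_le
    have h0 : (κ.restrict (W k)) G < ε := by
      refine lt_of_le_of_lt ?_ hε
      exact (Measure.restrict_apply_le _ _).trans hκG.le
    obtain ⟨V, hGV, hVo, hVε⟩ := G.exists_isOpen_lt_of_lt ε h0
    calc Q {ω | ω (σ ω) ∈ G ∩ W k} ≤ Q {ω | ω (σ ω) ∈ V ∩ W k} :=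
          measure_mono fun ω hω => ⟨hGV hω.1, hω.2⟩
      _ ≤ ∫⁻ y, A.N y {z | y + z ∈ V ∩ W k} ∂η :=
          hQ.measure_eval_mem_open_le hA hD hx hσ hσT hocc (hVo.inter (hWo k))
            (Metric.isBounded_ball.subset (inter_subset_right.trans inter_subset_right))
            ((hWD k).mono_left inter_subset_right)
      _ = (κ.restrict (W k)) V := by
          rw [Measure.restrict_apply hVo.measurableSet, hκ (hVo.inter (hWo k)).measurableSet]
      _ < ε := hVε
  have hall : ∀ᵐ ω ∂Q, ∀ k, ω (σ ω) ∉ G ∩ W k := by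
    refine ae_all_iff.2 fun k => ?_
    rw [ae_iff]
    simpa using hk k
  filter_upwards [hall] with ω hω hmem
  have hpos : 0 < Metric.infDist (ω (σ ω)) D := by
    rw [← Metric.infDist_closure]
    exact (isClosed_closure.notMem_iff_infDist_pos ⟨x, subset_closure hx⟩).1
      fun h => hGD.le_bot ⟨hmem, h⟩
  obtain ⟨k₁, hk₁⟩ := exists_nat_one_div_lt hpos
  obtain ⟨k₂, hk₂⟩ := exists_nat_gt ‖ω (σ ω)‖
  refine hω (max k₁ k₂) ⟨hmem, ?_, ?_⟩
  · refine lt_of_le_of_lt ?_ hk₁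
    exact one_div_le_one_div_of_le (by positivity) (by gcongr; exact le_max_left _ _)
  · rw [mem_ball_zero_iff]
    refine hk₂.trans_le ?_
    exact_mod_cast le_max_right k₁ k₂

/-! ### Discounting -/

/-- If `0 ≤ c ≤ C`, then `∫₀ᵀ e^{-C r} c(r) dr ≤ 1 - exp (-∫₀ᵀ c)`. The difference `g` of the two
sides satisfies `g(t) - g(s) ≥ -C² (t - s)²` for `s ≤ t`, hence `g(T) ≥ 0`. -/
theorem integral_exp_mul_le_one_sub_exp {c : ℝ → ℝ} (hc : Measurable c) {C : ℝ}
    (h0 : ∀ r, 0 ≤ c r) (hC : ∀ r, c r ≤ C) {T : ℝ} (hT : 0 ≤ T) :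
    ∫ r in (0 : ℝ)..T, Real.exp (-C * r) * c r ≤ 1 - Real.exp (-∫ r in (0 : ℝ)..T, c r) := by
  have hC0 : 0 ≤ C := (h0 0).trans (hC 0)
  have hci : ∀ a b, IntervalIntegrable c volume a b := fun a b =>
    (intervalIntegrable_const (c := C)).mono_fun hc.aestronglyMeasurable
      (Eventually.of_forall fun r => by
        simpa only [Real.norm_of_nonneg (h0 r), Real.norm_of_nonneg hC0] using hC r)
  have hei : ∀ a b, IntervalIntegrable (fun r => Real.exp (-C * r) * c r) volume a b := fun a b =>
    (hci a b).continuousOn_mul (by fun_prop)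
  set a : ℝ → ℝ := fun t => ∫ r in (0 : ℝ)..t, c r with ha
  set e : ℝ → ℝ := fun t => ∫ r in (0 : ℝ)..t, Real.exp (-C * r) * c r with he
  have ha_sub : ∀ s t, a t - a s = ∫ r in s..t, c r := fun s t =>
    intervalIntegral.integral_interval_sub_left (hci _ _) (hci _ _)
  have ha_le : ∀ s t, s ≤ t → a t - a s ≤ C * (t - s) := by
    intro s t hst
    rw [ha_sub]
    have := intervalIntegral.integral_mono_on hst (hci s t)
      (intervalIntegrable_const (c := C)) (fun r _ => hC r)
    simpa [mul_comm] using this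
  have ha_ge : ∀ s t, s ≤ t → 0 ≤ a t - a s := by
    intro s t hst
    rw [ha_sub]
    exact intervalIntegral.integral_nonneg hst fun r _ => h0 r
  let g : ℝ → ℝ := fun t => (1 - Real.exp (-a t)) - e t
  have hstep : ∀ s t, 0 ≤ s → s ≤ t → -(C ^ 2 * (t - s) ^ 2) ≤ g t - g s := by
    intro s t hs hst
    have he_le : e t - e s ≤ Real.exp (-C * s) * (a t - a s) := by
      have h1 : e t - e s = ∫ r in s..t, Real.exp (-C * r) * c r :=
        intervalIntegral.integral_interval_sub_left (hei _ _) (hei _ _)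
      rw [h1, ha_sub, ← intervalIntegral.integral_const_mul]
      refine intervalIntegral.integral_mono_on hst (hei s t) ((hci s t).const_mul _) fun r hr => ?_
      refine mul_le_mul_of_nonneg_right (Real.exp_le_exp.2 ?_) (h0 r)
      nlinarith [hr.1]
    have h2 : Real.exp (-a t) * (a t - a s) ≤ Real.exp (-a s) - Real.exp (-a t) := by
      have h3 : Real.exp (-a s) = Real.exp (-a t) * Real.exp (a t - a s) := by
        rw [← Real.exp_add]; ring_nf
      have h4 := Real.add_one_le_exp (a t - a s)
      nlinarith [Real.exp_pos (-a t)]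
    have h5 : Real.exp (-C * t) ≤ Real.exp (-a t) := by
      have h6 := ha_le 0 t (hs.trans hst)
      have h7 : a 0 = 0 := by simp [ha]
      exact Real.exp_le_exp.2 (by linarith)
    have h8 : Real.exp (-C * s) - Real.exp (-C * t) ≤ C * (t - s) := by
      have h9 : Real.exp (-C * t) = Real.exp (-C * s) * Real.exp (-(C * (t - s))) := by
        rw [← Real.exp_add]; ring_nf
      have h10 := Real.one_sub_le_exp_neg (C * (t - s))
      have h11 : Real.exp (-C * s) ≤ 1 := Real.exp_le_one_iff.2 (by nlinarith)
      have h12 : 0 ≤ C * (t - s) := mul_nonneg hC0 (sub_nonneg.2 hst)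
      nlinarith [Real.exp_pos (-C * s)]
    have h13 := ha_ge s t hst
    have h14 := ha_le s t hst
    have h15 : Real.exp (-C * t) * (a t - a s) ≤ Real.exp (-a t) * (a t - a s) :=
      mul_le_mul_of_nonneg_right h5 h13
    have h16 : (Real.exp (-C * s) - Real.exp (-C * t)) * (a t - a s)
        ≤ (C * (t - s)) * (C * (t - s)) :=
      mul_le_mul h8 h14 h13 (mul_nonneg hC0 (sub_nonneg.2 hst))
    simp only [g]
    nlinarith
  have hg0 : g 0 = 0 := by simp [g, ha, he]
  have hn : ∀ n : ℕ, -(C ^ 2 * T ^ 2 * (1 / ((n : ℝ) + 1))) ≤ g T := by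
    intro n
    have hpos : (0 : ℝ) < (n : ℝ) + 1 := by positivity
    let p : ℕ → ℝ := fun i => i * (T / ((n : ℝ) + 1))
    have hsum := Finset.sum_range_sub (fun i => g (p i)) (n + 1)
    have hp0 : g (p 0) = 0 := by simpa [p] using hg0
    have hp1 : p (n + 1) = T := by simp only [p]; push_cast; field_simp
    rw [hp0, hp1, sub_zero] at hsum
    rw [← hsum]
    have : ∀ i ∈ Finset.range (n + 1),
        -(C ^ 2 * (T / ((n : ℝ) + 1)) ^ 2) ≤ g (p (i + 1)) - g (p i) := by
      intro i _
      have hd : p (i + 1) - p i = T / ((n : ℝ) + 1) := by simp only [p]; push_cast; ring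
      have h1 : 0 ≤ T / ((n : ℝ) + 1) := by positivity
      have := hstep (p i) (p (i + 1)) (by positivity) (by linarith)
      rwa [hd] at this
    refine le_trans (le_of_eq ?_) (Finset.card_nsmul_le_sum _ _ _ this)
    simp only [Finset.card_range, nsmul_eq_mul]
    push_cast
    field_simp
  have hlim : Tendsto (fun n : ℕ => -(C ^ 2 * T ^ 2 * (1 / ((n : ℝ) + 1)))) atTop (𝓝 0) := by
    simpa using (tendsto_one_div_add_atTop_nhds_zero_nat.const_mul (C ^ 2 * T ^ 2)).neg
  have := le_of_tendsto' hlim hn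
  simp only [g] at this
  linarith

theorem discount_pos (c : Space d → ℝ) (t : ℝ≥0) (ω : Path d) : 0 < discount c t ω :=
  Real.exp_pos _

theorem discount_le_one {c : Space d → ℝ} {D : Set (Space d)} (hc : ∀ y ∈ D, 0 ≤ c y) {t : ℝ≥0}
    {ω : Path d} (h : ∀ r ∈ Ioo (0 : ℝ) t, ω r.toNNReal ∈ D) : discount c t ω ≤ 1 := by
  rw [discount, Real.exp_le_one_iff, neg_nonpos, intervalIntegral.integral_of_le t.coe_nonneg,
    integral_Ioc_eq_integral_Ioo]
  exact setIntegral_nonneg measurableSet_Ioo fun r hr => hc _ (h r hr)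

theorem discount_congr {c c' : Space d → ℝ} {D : Set (Space d)} (hc : ∀ y ∈ D, c y = c' y)
    {t : ℝ≥0} {ω : Path d} (h : ∀ r ∈ Ioo (0 : ℝ) t, ω r.toNNReal ∈ D) :
    discount c t ω = discount c' t ω := by
  rw [discount, discount, intervalIntegral.integral_of_le t.coe_nonneg,
    intervalIntegral.integral_of_le t.coe_nonneg, integral_Ioc_eq_integral_Ioo,
    integral_Ioc_eq_integral_Ioo]
  rw [setIntegral_congr_fun measurableSet_Ioo fun r hr => hc _ (h r hr)]

theorem exp_neg_mul_le_discount {c : Space d → ℝ} {C : ℝ} (hC : ∀ y, |c y| ≤ C) (t : ℝ≥0)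
    (ω : Path d) : Real.exp (-C * t) ≤ discount c t ω := by
  refine Real.exp_le_exp.2 ?_
  have := (abs_le.1 (abs_integral_path_le hC ω t)).2
  linarith

theorem gauge_le_one (P : Kernel (Space d) (Path d)) {D : Set (Space d)} {c : Space d → ℝ}
    (hc : ∀ y ∈ D, 0 ≤ c y) (y : Space d) [IsProbabilityMeasure (P y)] :
    gauge P D c y ≤ 1 := by
  refine (le_abs_self _).trans ?_
  rw [← Real.norm_eq_abs]
  have hone : (1 : ℝ) * (P y).real univ = 1 := by simp
  refine (norm_integral_le_of_norm_le_const (Eventually.of_forall fun ω => ?_)).trans hone.le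
  split_ifs with h
  · have hb : BddBelow (range fun t : ℝ≥0 => discount c t ω) :=
      ⟨0, by rintro _ ⟨t, rfl⟩; exact (discount_pos c t ω).le⟩
    rw [Real.norm_of_nonneg (le_ciInf fun t => (discount_pos c t ω).le)]
    exact (ciInf_le hb 0).trans (by simp [discount])
  · rw [Real.norm_of_nonneg (discount_pos _ _ _).le]
    refine discount_le_one hc fun r hr => mem_of_lt_exitTime (Real.toNNReal_pos.2 hr.1) ?_
    have h1 : r.toNNReal < (exitTime D ω).toNNReal := by
      rw [Real.toNNReal_lt_iff_lt_coe hr.1.le]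
      exact hr.2
    rw [← ENNReal.coe_toNNReal h]
    exact ENNReal.coe_lt_coe.2 h1

/-! ### The Hopf inequality -/

theorem le_ofReal_sub_of_le_coe_sub {a b : ℝ} {I : ℝ≥0∞}
    (h : (a : EReal) ≤ (b : EReal) - (I : EReal)) : a ≤ b ∧ I ≤ ENNReal.ofReal (b - a) := by
  induction I with
  | top => simp at h
  | coe i =>
    have h1 : a ≤ b - i := by
      change (a : EReal) ≤ (b : EReal) - ((i : ℝ) : EReal) at h
      exact_mod_cast h
    refine ⟨h1.trans (sub_le_self _ i.2), ?_⟩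
    rw [ENNReal.le_ofReal_iff_toReal_le ENNReal.coe_ne_top (by have := i.2; linarith)]
    simp only [ENNReal.coe_toReal]
    linarith

/-- Heuristically, the process stopped at `τ_D ∧ T` is almost surely in `D_S`. As `D_S` need not be
Borel, this is stated through the values of a Borel function: `{u > sup_{D_S} u}` is a Borel set off
`closure D`, and `N(y, ·)` does not charge its translate by `-y` when `y ∈ D`. -/
theorem SolvesMartingaleProblem.ae_le_sSup {A : Coefficients d} (hA : A.Admissible)
    {x : Space d} {Q : Measure (Path d)} (hQ : SolvesMartingaleProblem A (Measure.dirac x) Q)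
    {D : Set (Space d)} (hD : IsOpen D) (hx : x ∈ D) {σ : Path d → ℝ≥0} (hσ : IsOptionalTime σ)
    {T : ℝ≥0} (hσT : ∀ ω, σ ω ≤ T) (hστ : ∀ᵐ ω ∂Q, exitTimeMin D T ω = σ ω)
    {u : Space d → ℝ} (hu : Measurable u) (hub : BddAbove (u '' A.extClosure D)) :
    ∀ᵐ ω ∂Q, u (ω (σ ω)) ≤ sSup (u '' A.extClosure D) := by
  have := hQ.isProbabilityMeasure
  have hle : ∀ y ∈ A.extClosure D, u y ≤ sSup (u '' A.extClosure D) := fun y hy =>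
    le_csSup hub (mem_image_of_mem u hy)
  have hocc : ∀ᵐ y ∂(occupation Q σ), y ∈ D := by
    refine ae_occupation_mem hσ.measurable hD.measurableSet ?_
    filter_upwards [hστ] with ω hω r hr
    rw [← hω] at hr
    exact mem_of_lt_exitTimeMin hr
  have hG := hQ.ae_eval_notMem hA hD hx hσ hσT hocc
    (G := {y | sSup (u '' A.extClosure D) < u y}) (measurableSet_lt measurable_const hu) ?_ ?_
  · filter_upwards [hG] with ω hω using not_lt.1 hω
  · rw [Set.disjoint_left]
    intro y hy hyD
    rw [closure_eq_self_union_frontier] at hyD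
    refine absurd (hle y ?_) (not_le.2 hy)
    rcases hyD with h | h
    · exact Or.inr h
    · exact Or.inl (Or.inl h)
  · intro y hy
    refine measure_mono_null ?_ (Measure.measure_compl_support (μ := A.N y))
    intro z hz hsupp
    refine absurd (hle (y + z) ?_) (not_le.2 hz)
    have hmem : y + z ∈ A.nonlocalRange D :=
      mem_iUnion₂.2 ⟨y, hy, mem_image_of_mem (fun w => y + w) hsupp⟩
    by_cases h : y + z ∈ D
    · exact Or.inr h
    · exact Or.inl (Or.inr ⟨hmem, h⟩)

/-- The inequality before `τ_D ∧ T`, with `e_c` bounded below by `e^{-C r}`, where `C` is a bound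
of `c`. The functions `c'` and `g'` agree with `c` and `g` on `D`, and `c'` is non-negative, Borel
and bounded on the whole space. -/
theorem SolvesMartingaleProblem.lintegral_exitTimeMin_le {A : Coefficients d} (hA : A.Admissible)
    {P : Kernel (Space d) (Path d)} {x : Space d}
    (hQ : SolvesMartingaleProblem A (Measure.dirac x) (P x))
    {D : Set (Space d)} (hD : IsOpen D) (hx : x ∈ D) {c g u : Space d → ℝ}
    (hu : IsWeakSubsolution P D c g u) {c' g' : Space d → ℝ} (hc' : Measurable c')
    (hcc : ∀ y ∈ D, c y = c' y) (hgg : ∀ y ∈ D, g y = g' y) {C : ℝ}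
    (hc0 : ∀ y, 0 ≤ c' y) (hcC : ∀ y, c' y ≤ C)
    (hu_nonneg : 0 ≤ sSup (u '' A.extClosure D)) (T : ℝ≥0) :
    ∫⁻ ω, (∫⁻ r in Ioo (0 : ℝ) (exitTimeMin D T ω), ENNReal.ofReal (Real.exp (-C * r)) *
      (ENNReal.ofReal (sSup (u '' A.extClosure D)) * ENNReal.ofReal (c' (ω r.toNNReal))
        + ENNReal.ofReal (-g' (ω r.toNNReal)))) ∂(P x)
      ≤ ENNReal.ofReal (sSup (u '' A.extClosure D) - u x) := by
  have := hQ.isProbabilityMeasure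
  obtain ⟨B, hB⟩ := hu.bounded
  have hub : BddAbove (u '' A.extClosure D) :=
    ⟨B, by rintro _ ⟨y, -, rfl⟩; exact (abs_le.1 (hB y)).2⟩
  obtain ⟨σ, hσ, hσT, hστ⟩ := hQ.exists_optionalTime_ae_eq_exitTimeMin hA hD hx T
  have huσ := hQ.ae_le_sSup hA hD hx hσ hσT hστ hu.measurable hub
  set U : ℝ := sSup (u '' A.extClosure D) with hU
  have hcabs : ∀ y, |c' y| ≤ C := fun y => by rw [abs_of_nonneg (hc0 y)]; exact hcC y
  let disc : Path d → ℝ := fun ω => discount c' (σ ω) ω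
  have hdm : Measurable disc :=
    Real.measurable_exp.comp (measurable_integral_path hc' hσ.measurable).neg
  have hd0 : ∀ ω, 0 ≤ disc ω := fun ω => (discount_pos _ _ _).le
  have hd1 : ∀ ω, disc ω ≤ 1 := fun ω =>
    discount_le_one (D := univ) (fun y _ => hc0 y) fun r _ => mem_univ _
  have hdi : Integrable disc (P x) := Integrable.of_bound hdm.aestronglyMeasurable 1
    (Eventually.of_forall fun ω => by rw [Real.norm_of_nonneg (hd0 ω)]; exact hd1 ω)
  have hdui : Integrable (fun ω : Path d => disc ω * u (ω (σ ω))) (P x) := by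
    refine Integrable.of_bound (hdm.mul
      (hu.measurable.comp (measurable_eval_time hσ.measurable))).aestronglyMeasurable B
      (Eventually.of_forall fun ω => ?_)
    rw [norm_mul, Real.norm_of_nonneg (hd0 ω)]
    exact (mul_le_of_le_one_left (abs_nonneg _) (hd1 ω)).trans (hB _)
  -- The subsolution inequality at time `T`, with the value at the exit position replaced by `U`.
  obtain ⟨hle1, hle2⟩ := le_ofReal_sub_of_le_coe_sub (hu.le_expectation x hx T)
  have hE : ∫ ω, discount c (exitTimeMin D T ω) ω * u (ω (exitTimeMin D T ω)) ∂(P x)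
      ≤ U * ∫ ω, disc ω ∂(P x) := by
    have h1 : ∫ ω, discount c (exitTimeMin D T ω) ω * u (ω (exitTimeMin D T ω)) ∂(P x)
        = ∫ ω, disc ω * u (ω (σ ω)) ∂(P x) := by
      refine integral_congr_ae ?_
      filter_upwards [hστ] with ω hω
      rw [discount_congr hcc fun r hr => mem_of_lt_exitTimeMin hr, hω]
    rw [h1, ← integral_const_mul]
    refine integral_mono_ae hdui (hdi.const_mul U) ?_
    filter_upwards [huσ] with ω hω
    rw [mul_comm U]
    exact mul_le_mul_of_nonneg_left hω (hd0 ω)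
  have hsplit : ENNReal.ofReal (U - u x) =
      ENNReal.ofReal (U * (1 - ∫ ω, disc ω ∂(P x)))
        + ENNReal.ofReal (U * ∫ ω, disc ω ∂(P x) - u x) := by
    have h1 : ∫ ω, disc ω ∂(P x) ≤ 1 := by
      simpa using integral_mono hdi (integrable_const (1 : ℝ)) hd1
    rw [← ENNReal.ofReal_add (mul_nonneg hu_nonneg (by linarith)) (by linarith)]
    congr 1
    ring
  -- The part of the inequality that comes from `c`.
  have hem : Measurable fun p : Path d × ℝ =>
      ENNReal.ofReal (Real.exp (-C * p.2)) * ENNReal.ofReal (c' (p.1 p.2.toNNReal)) :=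
    (ENNReal.measurable_ofReal.comp (by fun_prop)).mul
      (hc'.comp measurable_eval_real).ennreal_ofReal
  have hcpart : ENNReal.ofReal U * ∫⁻ ω, (∫⁻ r in Ioo (0 : ℝ) (σ ω),
      ENNReal.ofReal (Real.exp (-C * r)) * ENNReal.ofReal (c' (ω r.toNNReal))) ∂(P x)
      ≤ ENNReal.ofReal (U * (1 - ∫ ω, disc ω ∂(P x))) := by
    rw [ENNReal.ofReal_mul hu_nonneg]
    gcongr
    have h1 : 1 - ∫ ω, disc ω ∂(P x) = ∫ ω, (1 - disc ω) ∂(P x) := by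
      rw [integral_sub (integrable_const _) hdi]
      simp
    have hdi' : Integrable (fun ω => 1 - disc ω) (P x) := (integrable_const _).sub hdi
    rw [h1, ofReal_integral_eq_lintegral_ofReal hdi'
      (Eventually.of_forall fun ω => sub_nonneg.2 (hd1 ω))]
    refine lintegral_mono fun ω => ?_
    have hm : Measurable fun r : ℝ => c' (ω r.toNNReal) := hc'.comp ω.measurable_comp_real
    have hi : IntervalIntegrable (fun r : ℝ => Real.exp (-C * r) * c' (ω r.toNNReal)) volume
        0 (σ ω) := (intervalIntegrable_path hc' hcabs ω _ _).continuousOn_mul (by fun_prop)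
    have hi' : IntegrableOn (fun r : ℝ => Real.exp (-C * r) * c' (ω r.toNNReal))
        (Ioo (0 : ℝ) (σ ω)) :=
      ((intervalIntegrable_iff_integrableOn_Ioo_of_le (σ ω).coe_nonneg).1 hi)
    have h2 := integral_exp_mul_le_one_sub_exp hm (fun r => hc0 _) (fun r => hcC _)
      (σ ω).coe_nonneg
    refine le_trans (le_of_eq ?_) (ENNReal.ofReal_le_ofReal h2)
    rw [intervalIntegral.integral_of_le (σ ω).coe_nonneg, integral_Ioc_eq_integral_Ioo,
      ofReal_integral_eq_lintegral_ofReal hi' (Eventually.of_forall fun r =>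
        mul_nonneg (Real.exp_pos _).le (hc0 _))]
    refine lintegral_congr fun r => ?_
    rw [ENNReal.ofReal_mul (Real.exp_pos _).le]
  -- The part of the inequality that comes from `g`.
  have hgpart : ∫⁻ ω, (∫⁻ r in Ioo (0 : ℝ) (exitTimeMin D T ω),
      ENNReal.ofReal (Real.exp (-C * r)) * ENNReal.ofReal (-g' (ω r.toNNReal))) ∂(P x)
      ≤ ENNReal.ofReal (U * ∫ ω, disc ω ∂(P x) - u x) := by
    refine le_trans (lintegral_mono fun ω => ?_)
      (hle2.trans (ENNReal.ofReal_le_ofReal (by linarith)))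
    refine setLIntegral_mono_ae' measurableSet_Ioo (Eventually.of_forall fun r hr => ?_)
    have hrD := mem_of_lt_exitTimeMin hr
    have hd : discount c r.toNNReal ω = discount c' r.toNNReal ω := by
      refine discount_congr hcc fun s hs => mem_of_lt_exitTimeMin (T := T) ⟨hs.1, hs.2.trans ?_⟩
      rw [Real.coe_toNNReal r hr.1.le]
      exact hr.2
    rw [hd, ← hgg _ hrD, ENNReal.ofReal_mul (discount_pos _ _ _).le]
    gcongr
    have := exp_neg_mul_le_discount hcabs r.toNNReal ω
    rwa [Real.coe_toNNReal r hr.1.le] at this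
  rw [hsplit]
  refine le_trans (le_of_eq ?_) (add_le_add hcpart hgpart)
  rw [← lintegral_const_mul _ (measurable_lintegral_path hem hσ.measurable),
    ← lintegral_add_left ((measurable_lintegral_path hem hσ.measurable).const_mul _)]
  refine lintegral_congr_ae ?_
  filter_upwards [hστ] with ω hω
  have hmω : Measurable fun r : ℝ =>
      ENNReal.ofReal (Real.exp (-C * r)) * ENNReal.ofReal (c' (ω r.toNNReal)) :=
    hem.comp (measurable_const.prodMk measurable_id)
  rw [hω, ← lintegral_const_mul _ hmω, ← lintegral_add_left (hmω.const_mul _)]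
  refine lintegral_congr fun r => ?_
  ring

/-- The resolvent is the limit of its truncations at `τ_D ∧ n`. -/
theorem SolvesMartingaleProblem.resolvent_le {A : Coefficients d} (hA : A.Admissible)
    {P : Kernel (Space d) (Path d)} {x : Space d}
    (hQ : SolvesMartingaleProblem A (Measure.dirac x) (P x))
    {D : Set (Space d)} (hD : IsOpen D) (hx : x ∈ D) {C : ℝ} {F : Space d → ℝ≥0∞}
    (hF : Measurable F) {K : ℝ≥0∞}
    (h : ∀ n : ℕ, ∫⁻ ω, (∫⁻ r in Ioo (0 : ℝ) (exitTimeMin D n ω),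
      ENNReal.ofReal (Real.exp (-C * r)) * F (ω r.toNNReal)) ∂(P x) ≤ K) :
    resolvent P D C F x ≤ K := by
  have hGm : Measurable fun p : Path d × ℝ =>
      ENNReal.ofReal (Real.exp (-C * p.2)) * F (p.1 p.2.toNNReal) :=
    (ENNReal.measurable_ofReal.comp (by fun_prop)).mul (hF.comp measurable_eval_real)
  have hmono : ∀ ω : Path d, Monotone fun n : ℕ => Ioo (0 : ℝ) (exitTimeMin D (n : ℝ≥0) ω) := by
    intro ω m n hmn
    refine Ioo_subset_Ioo_right (NNReal.coe_le_coe.2 ?_)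
    rw [← ENNReal.coe_le_coe, coe_exitTimeMin, coe_exitTimeMin]
    exact min_le_min le_rfl (by exact_mod_cast hmn)
  calc resolvent P D C F x
      ≤ ∫⁻ ω, (⨆ n : ℕ, ∫⁻ r in Ioo (0 : ℝ) (exitTimeMin D n ω),
          ENNReal.ofReal (Real.exp (-C * r)) * F (ω r.toNNReal)) ∂(P x) := by
        refine lintegral_mono fun ω => ?_
        rw [← setLIntegral_iUnion_of_directed _ (hmono ω).directed_le]
        have hsub : {t : ℝ | 0 ≤ t ∧ ENNReal.ofReal t < exitTime D ω} ⊆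
            {0} ∪ ⋃ n : ℕ, Ioo (0 : ℝ) (exitTimeMin D n ω) := by
          rintro t ⟨ht0, ht⟩
          rcases ht0.eq_or_lt with h0 | h0
          · exact Or.inl h0.symm
          · right
            obtain ⟨n, hn⟩ := exists_nat_gt t
            refine mem_iUnion.2 ⟨n, h0, ?_⟩
            rw [← Real.toNNReal_lt_iff_lt_coe ht0, ← ENNReal.coe_lt_coe, coe_exitTimeMin]
            refine lt_min ht (ENNReal.coe_lt_coe.2 ?_)
            rw [Real.toNNReal_lt_iff_lt_coe ht0]
            simpa using hn
        refine (lintegral_mono_set hsub).trans ((lintegral_union_le _ _ _).trans ?_)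
        simp
    _ = ⨆ n : ℕ, ∫⁻ ω, (∫⁻ r in Ioo (0 : ℝ) (exitTimeMin D n ω),
          ENNReal.ofReal (Real.exp (-C * r)) * F (ω r.toNNReal)) ∂(P x) := by
        refine lintegral_iSup' (fun n => ?_) (Eventually.of_forall fun ω m n hmn =>
          lintegral_mono_set (hmono ω hmn))
        obtain ⟨σ, hσ, -, hστ⟩ := hQ.exists_optionalTime_ae_eq_exitTimeMin hA hD hx n
        refine ⟨_, measurable_lintegral_path hGm hσ.measurable, ?_⟩
        filter_upwards [hστ] with ω hω
        rw [hω]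
    _ ≤ K := iSup_le h

theorem measurable_indicator_of_subtype {α : Type*} [MeasurableSpace α] {D : Set α}
    (hD : MeasurableSet D) {f : α → ℝ} (hf : Measurable fun x : D => f x) :
    Measurable (D.indicator f) := by
  refine measurable_of_restrict_of_restrict_compl hD ?_ ?_
  · have : D.domRestrict (D.indicator f) = fun x : D => f x :=
      funext fun y => indicator_of_mem y.2 f
    rwa [this]
  · have : Dᶜ.domRestrict (D.indicator f) = fun _ => 0 :=
      funext fun y => indicator_of_notMem y.2 f
    rw [this]
    exact measurable_const

end LevyHopf

theorem theorem3p9 (d : ℕ)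
    -- the operator and a strong Markovian solution of its martingale problem
    (A : LevyHopf.Coefficients d) (hA : A.Admissible)
    (P : Kernel (LevyHopf.Space d) (LevyHopf.Path d))
    (hP : LevyHopf.IsStrongMarkovSolution A P)
    -- the open set, from which the process exits almost surely
    (D : Set (LevyHopf.Space d)) (hD : IsOpen D)
    (hET : ∀ x ∈ D, ∀ᵐ ω ∂(P x), LevyHopf.exitTime D ω < ⊤)
    -- `c` is non-negative, bounded and Borel on `D`
    (c : LevyHopf.Space d → ℝ) (hc_meas : Measurable (fun x : D => c x))
    (hc_nonneg : ∀ x ∈ D, 0 ≤ c x) (hc_bdd : BddAbove (c '' D))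
    -- `g` is non-positive and Borel on `D`
    (g : LevyHopf.Space d → ℝ) (hg_meas : Measurable (fun x : D => g x))
    (hg_nonpos : ∀ x ∈ D, g x ≤ 0)
    -- the minorization condition with `α = sup_D c`
    (ψ : LevyHopf.Space d → ℝ≥0) (ν : Measure (LevyHopf.Space d))
    (hM : LevyHopf.Minorization P D (sSup (c '' D)) ψ ν)
    -- a weak subsolution with non-negative supremum over `D_S`
    (u : LevyHopf.Space d → ℝ) (hu : LevyHopf.IsWeakSubsolution P D c g u)
    (hu_nonneg : 0 ≤ sSup (u '' A.extClosure D)) :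
    ∀ x ∈ D,
      (((ψ x : ℝ≥0∞) *
        (ENNReal.ofReal (sSup (u '' A.extClosure D)) *
            ∫⁻ y in D, ENNReal.ofReal (c y * LevyHopf.gauge P D c y) ∂ν
          + ∫⁻ y in D, ENNReal.ofReal (max (-g y) 0) ∂ν) : ℝ≥0∞) : EReal)
        ≤ ((sSup (u '' A.extClosure D) - u x : ℝ) : EReal) := by
  intro x hx
  have hQ := hP.solves x
  set U : ℝ := sSup (u '' A.extClosure D) with hU
  set C : ℝ := sSup (c '' D) with hC
  have hcC : ∀ y ∈ D, c y ≤ C := fun y hy => le_csSup hc_bdd (mem_image_of_mem c hy)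
  have hC0 : 0 ≤ C := (hc_nonneg x hx).trans (hcC x hx)
  -- `c` and `g` are extended by zero to Borel functions on the whole space.
  set c' : LevyHopf.Space d → ℝ := D.indicator c with hc'
  set g' : LevyHopf.Space d → ℝ := D.indicator g with hg'
  have hcm : Measurable c' :=
    LevyHopf.measurable_indicator_of_subtype hD.measurableSet hc_meas
  have hgm : Measurable g' :=
    LevyHopf.measurable_indicator_of_subtype hD.measurableSet hg_meas
  have hcc : ∀ y ∈ D, c y = c' y := fun y hy => (indicator_of_mem hy c).symm
  have hgg : ∀ y ∈ D, g y = g' y := fun y hy => (indicator_of_mem hy g).symm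
  have hc0 : ∀ y, 0 ≤ c' y := indicator_nonneg hc_nonneg
  have hcC' : ∀ y, c' y ≤ C := fun y => indicator_apply_le' (fun hy => hcC y hy) fun _ => hC0
  let F : LevyHopf.Space d → ℝ≥0∞ := fun y =>
    ENNReal.ofReal U * ENNReal.ofReal (c' y) + ENNReal.ofReal (-g' y)
  have hFm : Measurable F := (hcm.ennreal_ofReal.const_mul _).add hgm.neg.ennreal_ofReal
  have hres : LevyHopf.resolvent P D C F x ≤ ENNReal.ofReal (U - u x) :=
    hQ.resolvent_le hA hD hx hFm fun n =>
      hQ.lintegral_exitTimeMin_le hA hD hx hu hcm hcc hgg hc0 hcC' hu_nonneg n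
  -- The minorization condition applies to the truncations of `F`.
  let f : ℕ → LevyHopf.Space d → ℝ≥0 := fun n y =>
    U.toNNReal * (c' y).toNNReal + min (-g' y).toNNReal n
  have hfm : ∀ n, Measurable (f n) := fun n =>
    (hcm.real_toNNReal.const_mul _).add (hgm.neg.real_toNNReal.min measurable_const)
  have hfF : ∀ n y, (f n y : ℝ≥0∞) ≤ F y := by
    intro n y
    simp only [f, F, ENNReal.coe_add, ENNReal.coe_mul]
    refine add_le_add le_rfl (ENNReal.coe_le_coe.2 (min_le_left _ _))
  have hfn : ∀ n, (ψ x : ℝ≥0∞) * ∫⁻ y in D, (f n y : ℝ≥0∞) ∂ν ≤ ENNReal.ofReal (U - u x) := by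
    intro n
    refine (hM.le_resolvent (f n) (hfm n) ⟨U.toNNReal * C.toNNReal + n, fun y => ?_⟩ x hx).trans
      (le_trans ?_ hres)
    · simp only [f]
      gcongr
      · exact hcC' y
      · exact min_le_right _ _
    · refine lintegral_mono fun ω => lintegral_mono fun t => ?_
      gcongr
      exact hfF n _
  have hFsup : ∀ y, F y ≤ ⨆ n, (f n y : ℝ≥0∞) := by
    intro y
    obtain ⟨n, hn⟩ := exists_nat_ge (-g' y).toNNReal
    refine le_iSup_of_le n ?_
    simp only [f, F, min_eq_left hn, ENNReal.coe_add, ENNReal.coe_mul]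
    exact le_rfl
  have hψF : (ψ x : ℝ≥0∞) * ∫⁻ y in D, F y ∂ν ≤ ENNReal.ofReal (U - u x) := by
    have hmono : Monotone fun n y => (f n y : ℝ≥0∞) := by
      intro m n hmn y
      refine ENNReal.coe_le_coe.2 (add_le_add le_rfl (min_le_min le_rfl ?_))
      exact_mod_cast hmn
    calc (ψ x : ℝ≥0∞) * ∫⁻ y in D, F y ∂ν
        ≤ ψ x * ∫⁻ y in D, (⨆ n, (f n y : ℝ≥0∞)) ∂ν := by
          gcongr with y
          exact hFsup y
      _ = ⨆ n, (ψ x : ℝ≥0∞) * ∫⁻ y in D, (f n y : ℝ≥0∞) ∂ν := by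
          rw [lintegral_iSup (fun n => (hfm n).coe_nnreal_ennreal) hmono, ENNReal.mul_iSup]
      _ ≤ _ := iSup_le hfn
  -- The gauge function is at most one, hence can be dropped.
  have hgauge : ENNReal.ofReal U * ∫⁻ y in D, ENNReal.ofReal (c y * LevyHopf.gauge P D c y) ∂ν
      + ∫⁻ y in D, ENNReal.ofReal (max (-g y) 0) ∂ν ≤ ∫⁻ y in D, F y ∂ν := by
    rw [lintegral_add_left (hcm.ennreal_ofReal.const_mul _),
      lintegral_const_mul _ hcm.ennreal_ofReal]
    gcongr ENNReal.ofReal U * ?_ + ?_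
    · refine setLIntegral_mono' hD.measurableSet fun y hy => ENNReal.ofReal_le_ofReal ?_
      have := (hP.solves y).isProbabilityMeasure
      rw [← hcc y hy]
      exact mul_le_of_le_one_right (hc_nonneg y hy) (LevyHopf.gauge_le_one P hc_nonneg y)
    · refine setLIntegral_mono' hD.measurableSet fun y hy => ?_
      rw [← hgg y hy, max_eq_left (neg_nonneg.2 (hg_nonpos y hy))]
  have huU : 0 ≤ U - u x := by
    obtain ⟨B, hB⟩ := hu.bounded
    refine sub_nonneg.2 (le_csSup ⟨B, ?_⟩ (mem_image_of_mem u (Or.inr hx)))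
    rintro _ ⟨y, -, rfl⟩
    exact (abs_le.1 (hB y)).2
  have hfinal := (mul_le_mul_right hgauge (ψ x : ℝ≥0∞)).trans hψF
  refine (EReal.coe_ennreal_le_coe_ennreal_iff.2 hfinal).trans (le_of_eq ?_)
  rw [EReal.coe_ennreal_ofReal, max_eq_left huU]
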